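/- Let $M$ be a compact connected Riemann surface and let $f$ be a meromorphic function on $M$ that is not identically zero (for instance, any non-constant one). Let $m$ be its degree, i.e. the number of its poles counted with multiplicity. Then $f$ has $m$ zeros $\omega_1,\dots,\omega_m$ and $m$ poles $\xi_1,\dots,\xi_m$, each repeated according to its multiplicity. The two-form $\frac{d\bar f\wedge df}{(1+f\bar f)^2}$ and the one-forms $\frac{df}{f(1+f\bar f)}$ and $\frac{\bar f\,df}{1+f\bar f}$ have locally integrable coefficients on $M$, hence define currents, and in the sense of currents $$ \frac{d\bar f\wedge df}{(1+f\bar f)^2} =-d\Big(\frac{df}{f(1+f\bar f)}\Big)+\pi\sum_{k=1}^m\delta_{\omega_k}\,d\bar\zeta\wedge d\zeta = d\Big(\frac{\bar f\,df}{1+f\bar f}\Big)+\pi\sum_{j=1}^m\delta_{\xi_j}\,d\bar\zeta\wedge d\zeta . $$ Here $M$ carries its complex orientation, and equality in the sense of currents means equality of the pairings with every $\varphi\in C^\infty(M,\mathbb C)$: a locally integrable two-form $\Omega$ acts by $\int_M\varphi\,\Omega$, the exterior derivative $d\eta$ of a locally integrable one-form $\eta$ acts by $\int_M\eta\wedge d\varphi=-\int_M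 d\varphi\wedge\eta$, and the Dirac current $\delta_p\,d\bar\zeta\wedge d\zeta=2i\,\delta_p\,dx\wedge dy$ (with $\zeta=x+iy$ a local coordinate at $p$) acts by $2i\,\varphi(p)$. -/

import Mathlib

open scoped Manifold ContDiff

/-! ### Riemann surfaces

A Riemann surface is a Hausdorff space `M` with a holomorphic atlas, i.e. `[ChartedSpace ℂ M]`
and `[IsManifold 𝓘(ℂ) ω M]`. Smooth functions and differential forms are taken with respect to the
underlying real two-dimensional structure `𝓘(ℝ, ℂ)`. -/

/-- The real smooth structure underlying a Riemann surface. -/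
theorem RiemannSurface.isManifold_real (M : Type*) [TopologicalSpace M] [ChartedSpace ℂ M]
    [IsManifold 𝓘(ℂ) ω M] : IsManifold 𝓘(ℝ, ℂ) ∞ M := by
  refine isManifold_of_contDiffOn _ _ _ fun e e' he he' => ?_
  have h := (mem_groupoid_of_pregroupoid.mp
    (HasGroupoid.compatible (G := contDiffGroupoid ω 𝓘(ℂ)) he he')).1
  have h' : ContDiffOn ℂ ω (e.symm.trans e') (e.symm.trans e').source := by
    simpa [contDiffPregroupoid] using h
  have h'' := (h'.restrict_scalars ℝ).of_le (m := ∞) le_top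
  simpa using h''

namespace RiemannSurface

/-! ### Differential forms -/

/-- Complex-valued differential one-forms on `M` (not assumed to be smooth). -/
abbrev OneForm (M : Type*) [TopologicalSpace M] [ChartedSpace ℂ M] : Type _ :=
  ∀ p : M, TangentSpace 𝓘(ℝ, ℂ) p →L[ℝ] ℂ

/-- Complex-valued differential two-forms on `M` (not assumed to be smooth). -/
abbrev TwoForm (M : Type*) [TopologicalSpace M] [ChartedSpace ℂ M] : Type _ :=
  ∀ p : M, TangentSpace 𝓘(ℝ, ℂ) p [⋀^Fin 2]→L[ℝ] ℂ

section Forms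

variable {M : Type*} [TopologicalSpace M] [ChartedSpace ℂ M]

/-- The differential `df` of a complex-valued function. -/
noncomputable def d (f : M → ℂ) : OneForm M :=
  fun p => mfderiv 𝓘(ℝ, ℂ) 𝓘(ℝ, ℂ) f p

/-- The complex conjugate of a one-form; the conjugate of `df` is the differential of the
conjugate of `f`. -/
noncomputable def conjForm (α : OneForm M) : OneForm M :=
  fun p => (Complex.conjCLE : ℂ →L[ℝ] ℂ).comp (α p)

/-- The wedge product of two one-forms, `(α ∧ β)(u, v) = α u * β v - α v * β u`. -/
noncomputable def wedge (α β : OneForm M) : TwoForm M := fun p =>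
  ContinuousMultilinearMap.alternatization
    ((ContinuousMultilinearMap.mkPiAlgebra ℝ (Fin 2) ℂ).compContinuousLinearMap ![α p, β p])

theorem wedge_apply (α β : OneForm M) (p : M) (v : Fin 2 → TangentSpace 𝓘(ℝ, ℂ) p) :
    wedge α β p v = α p (v 0) * β p (v 1) - α p (v 1) * β p (v 0) := by
  have h : (Finset.univ : Finset (Equiv.Perm (Fin 2))) = {1, Equiv.swap 0 1} := by decide
  have h' : (1 : Equiv.Perm (Fin 2)) ≠ Equiv.swap 0 1 := by decide
  simp [wedge, ContinuousMultilinearMap.alternatization_apply_apply, h, Finset.sum_pair h',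
    Fin.prod_univ_two, sub_eq_add_neg]

/-- The vector `v` at the point `z` of a coordinate domain, transported to `M` by the chart `e`.
For `v = 1` and `v = I` these are the coordinate fields `∂/∂x` and `∂/∂y`. -/
noncomputable def coordVec (e : OpenPartialHomeomorph M ℂ) (z v : ℂ) :
    TangentSpace 𝓘(ℝ, ℂ) (e.symm z) :=
  mfderiv 𝓘(ℝ, ℂ) 𝓘(ℝ, ℂ) e.symm z v

/-- The coefficient `η(∂_v)` of a one-form in the chart `e`. -/
noncomputable def coeffOne (e : OpenPartialHomeomorph M ℂ) (η : OneForm M) (v z : ℂ) : ℂ :=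
  η (e.symm z) (coordVec e z v)

/-- The coefficient `w` of a two-form in the chart `e`, where the form reads `w dx ∧ dy`. -/
noncomputable def coeffTwo (e : OpenPartialHomeomorph M ℂ) (Ω : TwoForm M) (z : ℂ) : ℂ :=
  Ω (e.symm z) ![coordVec e z 1, coordVec e z Complex.I]

/-- A one-form is locally integrable if its coefficients in all charts are. -/
def LocIntegrableOne (η : OneForm M) : Prop :=
  ∀ e ∈ atlas ℂ M, ∀ v : ℂ,
    MeasureTheory.LocallyIntegrableOn (coeffOne e η v) e.target MeasureTheory.volume

/-- A two-form is locally integrable if its coefficients in all charts are. -/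
def LocIntegrableTwo (Ω : TwoForm M) : Prop :=
  ∀ e ∈ atlas ℂ M,
    MeasureTheory.LocallyIntegrableOn (coeffTwo e Ω) e.target MeasureTheory.volume

end Forms

/-! ### Integration of two-forms and currents -/

section Currents

variable {M : Type*} [TopologicalSpace M] [ChartedSpace ℂ M] [IsManifold 𝓘(ℂ) ω M]
  [T2Space M] [CompactSpace M]

theorem exists_partitionOfUnity (M : Type*) [TopologicalSpace M] [ChartedSpace ℂ M]
    [IsManifold 𝓘(ℂ) ω M] [T2Space M] [CompactSpace M] :
    ∃ ρ : SmoothPartitionOfUnity M 𝓘(ℝ, ℂ) M Set.univ,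
      ρ.IsSubordinate (fun p => (chartAt ℂ p).source) := by
  have := isManifold_real M
  exact SmoothPartitionOfUnity.exists_isSubordinate_chartAt_source 𝓘(ℝ, ℂ) M

/-- A smooth partition of unity subordinate to the coordinate domains. -/
noncomputable def partitionOfUnity (M : Type*) [TopologicalSpace M] [ChartedSpace ℂ M]
    [IsManifold 𝓘(ℂ) ω M] [T2Space M] [CompactSpace M] :
    SmoothPartitionOfUnity M 𝓘(ℝ, ℂ) M Set.univ :=
  (exists_partitionOfUnity M).choose

theorem partitionOfUnity_isSubordinate :
    (partitionOfUnity M).IsSubordinate (fun p => (chartAt ℂ p).source) :=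
  (exists_partitionOfUnity M).choose_spec

/-- The integral of a two-form over the compact Riemann surface `M` with its complex orientation:
`∫_M Ω = ∑ p, ∫_M ρ_p Ω`, where `ρ_p` is a partition of unity subordinate to the
domains of the charts and the `p`-th summand is computed in the chart at `p`.
By compactness only finitely many `ρ_p` are nonzero. -/
noncomputable def integral (Ω : TwoForm M) : ℂ :=
  ∑ᶠ p : M, ∫ z in (chartAt ℂ p).target,
    ((partitionOfUnity M p ((chartAt ℂ p).symm z) : ℝ) : ℂ) * coeffTwo (chartAt ℂ p) Ω z

/-- The pairing with the test function `φ` of the current of degree two defined by the two-form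
`Ω`, that is `∫_M φ Ω`. -/
noncomputable def currentTwo (Ω : TwoForm M) (φ : M → ℂ) : ℂ :=
  integral (fun p => φ p • Ω p)

/-- The pairing with the test form `α` of the current of degree one defined by the one-form
`η`, that is `∫_M η ∧ α`. -/
noncomputable def currentOne (η : OneForm M) (α : OneForm M) : ℂ :=
  integral (wedge η α)

/-- The pairing with the test function `φ` of the exterior derivative `dT` of a current `T`
of degree one. With the convention `T_η(α) = ∫ η ∧ α` it is `(dT)(φ) = T(dφ)`, since
`∫ φ dη = ∫ η ∧ dφ` for smooth `η`, by Stokes and `d(φη) = dφ ∧ η + φ dη`. -/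
noncomputable def dCurrent (T : OneForm M → ℂ) (φ : M → ℂ) : ℂ :=
  T (d φ)

/-- The pairing with the test function `φ` of the Dirac current `δ_p dζ̄ ∧ dζ`. As
`dζ̄ ∧ dζ = 2i dx ∧ dy` and `δ_p dx ∧ dy` is the point mass at `p`, this is `2i φ(p)`. -/
noncomputable def diracCurrent (p : M) (φ : M → ℂ) : ℂ :=
  2 * Complex.I * φ p

end Currents

/-! ### Meromorphic functions -/

section Meromorphic

variable {M : Type*} [TopologicalSpace M] [ChartedSpace ℂ M]

/-- `f` is meromorphic on `M`: it is meromorphic in the chart around each point. The value of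
`f` at a pole carries no information. -/
def IsMeromorphic (f : M → ℂ) : Prop :=
  ∀ p : M, MeromorphicAt (f ∘ (chartAt ℂ p).symm) (chartAt ℂ p p)

/-- The order of the meromorphic function `f` at `p`; it is `⊤` if and only if `f` vanishes
identically in a punctured neighbourhood of `p`. -/
noncomputable def order (f : M → ℂ) (p : M) : WithTop ℤ :=
  meromorphicOrderAt (f ∘ (chartAt ℂ p).symm) (chartAt ℂ p p)

/-- The multiplicity of `p` as a zero of `f` (`0` if `p` is not a zero). -/
noncomputable def zeroMult (f : M → ℂ) (p : M) : ℕ :=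
  (order f p).untop₀.toNat

/-- The multiplicity of `p` as a pole of `f` (`0` if `p` is not a pole). -/
noncomputable def poleMult (f : M → ℂ) (p : M) : ℕ :=
  (-(order f p).untop₀).toNat

/-- The degree of a meromorphic function on a compact surface: the number of its poles, counted
with multiplicities. -/
noncomputable def degree (f : M → ℂ) : ℕ :=
  ∑ᶠ p : M, poleMult f p

/-- The finite family `a` lists the zeros of `f`, each one repeated according to multiplicity. -/
def ListsZeros (f : M → ℂ) {m : ℕ} (a : Fin m → M) : Prop :=
  ∀ p : M, {k : Fin m | a k = p}.ncard = zeroMult f p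

/-- The finite family `b` lists the poles of `f`, each one repeated according to multiplicity. -/
def ListsPoles (f : M → ℂ) {m : ℕ} (b : Fin m → M) : Prop :=
  ∀ p : M, {j : Fin m | b j = p}.ncard = poleMult f p

/-- The two-form `df̄ ∧ df / (1 + f f̄)²`. -/
noncomputable def sphericalForm (f : M → ℂ) : TwoForm M := fun p =>
  (1 / (1 + f p * (starRingEnd ℂ) (f p)) ^ 2) • wedge (conjForm (d f)) (d f) p

/-- The one-form `df / (f (1 + f f̄))`. -/
noncomputable def zeroPrimitive (f : M → ℂ) : OneForm M := fun p =>
  (1 / (f p * (1 + f p * (starRingEnd ℂ) (f p)))) • d f p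

/-- The one-form `f̄ df / (1 + f f̄)`. -/
noncomputable def polePrimitive (f : M → ℂ) : OneForm M := fun p =>
  ((starRingEnd ℂ) (f p) / (1 + f p * (starRingEnd ℂ) (f p))) • d f p

end Meromorphic

end RiemannSurface

/-! Away from zeros and poles both identities are the computation `∂̄(f̄ f' / (1 + f f̄)) = f̄' f' /
(1 + f f̄)²`; the Dirac masses come from the singularities. The partial fraction `1/(f(1 + f f̄)) =
1/f - f̄/(1 + f f̄)` splits the first primitive into the logarithmic derivative `df/f` minus the
second primitive. At a zero of order `n` only `df/f` is singular, with principal part `n/(z - z₀)`.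
At a pole, rewriting in terms of `1/f` shows that the first primitive extends smoothly. So near
every point its coefficient is `n⁺/(z - z₀) + s`, with `s` of class C¹ and `∂̄s` equal to minus the
spherical density (`exists_local_form`).

Tested on a function supported near `z₀`, the term `s` integrates by parts and the simple pole is
evaluated by the Cauchy–Pompeiu formula (`integral_inv_mul_dbar`); together they give
`integral_zeroCoeff_mul_dbar`. A two-form supported in one chart is integrated in that chart
(`integral_eq_setIntegral_chart`), and a partition of unity makes the residue formula global
(`IsMeromorphic.currentTwo_add_dCurrent`).

The identity at the poles is the identity at the zeros for `1/f`: inversion preserves the spherical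
form and exchanges the two primitives up to sign. Testing both identities on `φ = 1` shows that
there are as many zeros as poles. Connectedness enters only through the identity theorem, which
makes all orders finite; by compactness zeros and poles are then finite in number, so values of `f`
there do not affect any integral. -/

section

open MeasureTheory Set Filter Topology Complex ComplexConjugate

/-! ### The Cauchy–Pompeiu formula in the plane -/

/-- Twice the Wirtinger derivative `∂/∂z̄`. -/
noncomputable def dbar (u : ℂ → ℂ) (z : ℂ) : ℂ :=
  fderiv ℝ u z 1 + I * fderiv ℝ u z I

theorem continuous_dbar {ψ : ℂ → ℂ} (hψ : ContDiff ℝ 1 ψ) : Continuous (dbar ψ) := by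
  have h := hψ.continuous_fderiv one_ne_zero
  unfold dbar
  fun_prop

theorem support_dbar_subset (ψ : ℂ → ℂ) : Function.support (dbar ψ) ⊆ tsupport ψ := by
  intro z hz
  by_contra h
  apply hz
  have : fderiv ℝ ψ z = 0 := image_eq_zero_of_notMem_tsupport
    (fun h' => h (tsupport_fderiv_subset ℝ h'))
  simp [dbar, this]

theorem tsupport_dbar_subset (ψ : ℂ → ℂ) : tsupport (dbar ψ) ⊆ tsupport ψ :=
  closure_minimal (support_dbar_subset ψ) (isClosed_tsupport ψ)

/-- In polar coordinates the Jacobian `r` cancels the singularity `1/r`. -/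
theorem integrableOn_inv_sub_ball (z₀ : ℂ) (r : ℝ) :
    IntegrableOn (fun z : ℂ => (z - z₀)⁻¹) (Metric.ball z₀ r) := by
  have h0 : IntegrableOn (fun z : ℂ => (z : ℂ)⁻¹) (Metric.ball 0 r) := by
    have h := (integrableOn_fun_norm_addHaar (E := ℂ) volume (f := fun t : ℝ => t⁻¹) (r := r)).2 (by
      have : IntegrableOn (fun _ : ℝ => (1 : ℝ)) (Ioo 0 r) := by simp
      refine this.congr_fun (fun y hy => ?_) measurableSet_Ioo
      simp [Complex.finrank_real_complex, hy.1.ne'])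
    refine (integrable_norm_iff (by fun_prop)).1 ?_
    simpa [IntegrableOn] using h
  have hmp := measurePreserving_sub_right (volume : Measure ℂ) z₀
  have := (hmp.integrableOn_comp_preimage (MeasurableEquiv.subRight z₀).measurableEmbedding).2 h0
  have hb : Metric.ball z₀ r = (fun z => z - z₀) ⁻¹' Metric.ball 0 r := by
    ext z
    simp [dist_eq_norm]
  rw [hb]
  exact this

theorem locallyIntegrable_inv_sub (z₀ : ℂ) : LocallyIntegrable (fun z : ℂ => (z - z₀)⁻¹) := by
  intro z
  refine ⟨Metric.ball z₀ (dist z z₀ + 1), Metric.isOpen_ball.mem_nhds ?_,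
    integrableOn_inv_sub_ball _ _⟩
  simp

/-- The integrand is the derivative of `r ↦ ψ (r w)`, which vanishes for large `r`. -/
theorem integral_radial_deriv {ψ : ℂ → ℂ} (hψ : ContDiff ℝ 1 ψ) (hc : HasCompactSupport ψ)
    {w : ℂ} (hw : w ≠ 0) : ∫ r in Ioi (0 : ℝ), fderiv ℝ ψ (r * w) w = -ψ 0 := by
  have hd : ∀ r : ℝ, HasDerivAt (fun r : ℝ => ψ (r * w)) (fderiv ℝ ψ (r * w) w) r := by
    intro r
    have h1 : HasDerivAt (fun r : ℝ => (r : ℂ) * w) w r := by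
      simpa using (hasDerivAt_id r).ofReal_comp.mul_const w
    exact ((hψ.differentiable one_ne_zero _).hasFDerivAt).comp_hasDerivAt r h1
  have hcl : Topology.IsClosedEmbedding (fun r : ℝ => (r : ℂ) * w) :=
    (Homeomorph.mulRight₀ w hw).isClosedEmbedding.comp Complex.isUniformEmbedding_ofReal.isClosedEmbedding
  have hcs : HasCompactSupport (fun r : ℝ => ψ (r * w)) := hc.comp_isClosedEmbedding hcl
  have hcs' : HasCompactSupport (fun r : ℝ => fderiv ℝ ψ (r * w) w) :=
    ((hc.fderiv ℝ).comp_isClosedEmbedding hcl).comp_left (g := fun L : ℂ →L[ℝ] ℂ => L w) (by simp)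
  have hcont := hψ.continuous_fderiv one_ne_zero
  have hint : Integrable (fun r : ℝ => fderiv ℝ ψ (r * w) w) :=
    Continuous.integrable_of_hasCompactSupport (by fun_prop) hcs'
  have := integral_Ioi_of_hasDerivAt_of_tendsto (a := 0) (m := 0)
    (hd 0).continuousAt.continuousWithinAt (fun r _ => hd r) hint.integrableOn
    (by
      rw [hasCompactSupport_iff_eventuallyEq] at hcs
      rw [coclosedCompact_eq_cocompact] at hcs
      refine tendsto_const_nhds.congr' ?_
      filter_upwards [hcs.filter_mono atTop_le_cocompact] with r hr using hr.symm)
  simpa using this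

/-- The integrand is the `θ`-derivative of the `2π`-periodic function `ψ (r e^{iθ}) / r`. -/
theorem integral_angular_deriv {ψ : ℂ → ℂ} (hψ : ContDiff ℝ 1 ψ) {r : ℝ} (hr : r ≠ 0) :
    ∫ θ in Ioo (-Real.pi) Real.pi,
      fderiv ℝ ψ (r * exp (θ * I)) (I * exp (θ * I)) = 0 := by
  have hd : ∀ θ : ℝ, HasDerivAt (fun θ : ℝ => (r : ℂ)⁻¹ * ψ (r * exp (θ * I)))
      (fderiv ℝ ψ (r * exp (θ * I)) (I * exp (θ * I))) θ := by
    intro θ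
    have h1 : HasDerivAt (fun θ : ℝ => (r : ℂ) * exp (θ * I)) ((r : ℝ) • (I * exp (θ * I))) θ := by
      have := (((hasDerivAt_id θ).ofReal_comp.mul_const I).cexp).const_mul (r : ℂ)
      refine this.congr_deriv ?_
      simp only [id, real_smul, ofReal_one, one_mul]
      ring
    have := (((hψ.differentiable one_ne_zero _).hasFDerivAt).comp_hasDerivAt θ h1).const_mul
      ((r : ℂ)⁻¹)
    refine this.congr_deriv ?_
    rw [map_smul, real_smul, ← mul_assoc, inv_mul_cancel₀ (by exact_mod_cast hr), one_mul]
  have hcont := hψ.continuous_fderiv one_ne_zero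
  rw [← integral_Ioc_eq_integral_Ioo, ← intervalIntegral.integral_of_le (by linarith [Real.pi_pos]),
    intervalIntegral.integral_eq_sub_of_hasDerivAt (fun θ _ => hd θ)
      (Continuous.intervalIntegrable (by fun_prop) _ _)]
  simp [Complex.exp_neg]

/-- The Cauchy–Pompeiu formula for compactly supported functions. -/
theorem integral_inv_mul_dbar {ψ : ℂ → ℂ} (hψ : ContDiff ℝ 1 ψ) (hc : HasCompactSupport ψ) :
    ∫ z, z⁻¹ * dbar ψ z = -(2 * Real.pi) * ψ 0 := by
  have hcont := hψ.continuous_fderiv one_ne_zero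
  rw [← Complex.integral_comp_polarCoord_symm]
  set A : ℝ × ℝ → ℂ := fun p => fderiv ℝ ψ (p.1 * exp (p.2 * I)) (exp (p.2 * I)) with hA
  set B : ℝ × ℝ → ℂ := fun p => fderiv ℝ ψ (p.1 * exp (p.2 * I)) (I * exp (p.2 * I)) with hB
  have hcl : ∀ L : ℂ →L[ℝ] ℂ, ∀ w, L w = w.re * L 1 + w.im * L I := by
    intro L w
    conv_lhs => rw [show w = w.re • (1 : ℂ) + w.im • I by simp, map_add]
    rw [map_smul, map_smul, real_smul, real_smul]
  -- Since `dbar = e^{iθ} (∂_r + (i/r) ∂_θ)`, the factor `r z⁻¹ = e^{-iθ}` leaves exactly `A + i B`,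
  -- with `A` the radial derivative and `B` the angular one divided by `r`.
  have h1 : ∫ p in polarCoord.target, p.1 • ((Complex.polarCoord.symm p)⁻¹ *
      dbar ψ (Complex.polarCoord.symm p)) = ∫ p in polarCoord.target, (A p + I * B p) := by
    refine setIntegral_congr_fun polarCoord.open_target.measurableSet fun p hp => ?_
    have hp1 : (p.1 : ℂ) ≠ 0 := by
      have : 0 < p.1 := hp.1
      exact_mod_cast this.ne'
    have he : ((Real.cos p.2 : ℂ) + Real.sin p.2 * I) = exp (p.2 * I) := by
      rw [Complex.exp_mul_I]; simp
    simp only [Complex.polarCoord_symm_apply, he, hA, hB]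
    set D := fderiv ℝ ψ (p.1 * exp (p.2 * I)) with hD
    have hre : (exp (p.2 * I)).re = Real.cos p.2 := Complex.exp_ofReal_mul_I_re _
    have him : (exp (p.2 * I)).im = Real.sin p.2 := Complex.exp_ofReal_mul_I_im _
    rw [hcl D (exp _), hcl D (I * exp _)]
    simp only [dbar, ← hD, Complex.mul_re, Complex.mul_im, hre, him, I_re, I_im]
    have hinv : (exp (p.2 * I))⁻¹ = (Real.cos p.2 : ℂ) - Real.sin p.2 * I := by
      rw [← Complex.exp_neg, ← neg_mul, ← ofReal_neg, Complex.exp_mul_I, ← ofReal_cos, ← ofReal_sin]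
      simp
      ring
    rw [real_smul, mul_inv, hinv]
    push_cast
    field_simp
    ring_nf
    simp only [I_sq]
    ring
  have hK : ∀ g : ℝ × ℝ → ℂ, Continuous g → (∀ p, p.1 * exp (p.2 * I) ∉ tsupport ψ → g p = 0) →
      IntegrableOn g (Ioi (0 : ℝ) ×ˢ Ioo (-Real.pi) Real.pi) := by
    intro g hg hg0
    obtain ⟨R, hR⟩ := hc.isBounded.subset_closedBall 0
    have h2 : IntegrableOn g (Icc (0 : ℝ) R ×ˢ Icc (-Real.pi) Real.pi) :=
      hg.continuousOn.integrableOn_compact (isCompact_Icc.prod isCompact_Icc)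
    refine h2.of_forall_sdiff_eq_zero (measurableSet_Ioi.prod measurableSet_Ioo) ?_
    rintro p ⟨⟨hp1, hp2⟩, hp3⟩
    refine hg0 p fun hmem => hp3 ⟨⟨le_of_lt hp1, ?_⟩, Ioo_subset_Icc_self hp2⟩
    have := hR hmem
    simpa [Complex.norm_exp_ofReal_mul_I, abs_of_pos (show 0 < p.1 from hp1)] using this
  have hz : ∀ z, z ∉ tsupport ψ → fderiv ℝ ψ z = 0 := fun z hz =>
    image_eq_zero_of_notMem_tsupport (fun h' => hz (tsupport_fderiv_subset ℝ h'))
  have hAi := hK A (by fun_prop) (fun p hp => by simp [hA, hz _ hp])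
  have hBi := hK B (by fun_prop) (fun p hp => by simp [hB, hz _ hp])
  rw [h1]
  change ∫ p in Ioi (0 : ℝ) ×ˢ Ioo (-Real.pi) Real.pi, (A p + I * B p) = _
  rw [integral_add hAi (hBi.const_mul I), integral_const_mul]
  have hBz : ∫ p in Ioi (0 : ℝ) ×ˢ Ioo (-Real.pi) Real.pi, B p = 0 := by
    rw [Measure.volume_eq_prod] at hBi ⊢
    rw [setIntegral_prod _ hBi]
    refine (setIntegral_congr_fun measurableSet_Ioi fun r hr => ?_).trans (integral_zero _ _)
    exact integral_angular_deriv hψ (ne_of_gt hr)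
  have hAz : ∫ p in Ioi (0 : ℝ) ×ˢ Ioo (-Real.pi) Real.pi, A p = -(2 * Real.pi) * ψ 0 := by
    rw [Measure.volume_eq_prod] at hAi ⊢
    -- With the radial integral innermost, each ray contributes `-ψ 0`, and the angle contributes
    -- the length `2π`.
    rw [← setIntegral_prod_swap, setIntegral_prod _ (by simpa [Function.comp_def] using hAi.swap)]
    have : ∀ θ : ℝ, ∫ r in Ioi (0 : ℝ), A (Prod.swap (θ, r)) = -ψ 0 := fun θ =>
      integral_radial_deriv hψ hc (Complex.exp_ne_zero (θ * I))
    simp only [this]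
    simp [Measure.real, Real.volume_Ioo]
    left
    rw [ENNReal.toReal_ofReal (by linarith [Real.pi_pos])]
    push_cast
    ring
  rw [hBz, hAz]
  simp

theorem integral_inv_sub_mul_dbar {ψ : ℂ → ℂ} (hψ : ContDiff ℝ 1 ψ) (hc : HasCompactSupport ψ)
    (z₀ : ℂ) : ∫ z, (z - z₀)⁻¹ * dbar ψ z = -(2 * Real.pi) * ψ z₀ := by
  have h := integral_inv_mul_dbar (ψ := fun z => ψ (z + z₀)) (by fun_prop)
    (hc.comp_homeomorph (Homeomorph.addRight z₀))
  have h2 : ∀ z, dbar (fun z => ψ (z + z₀)) z = dbar ψ (z + z₀) := by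
    intro z
    simp [dbar, fderiv_comp_add_right]
  simp only [h2, zero_add] at h
  rw [← h, ← integral_add_right_eq_self (fun z => (z - z₀)⁻¹ * dbar ψ z) z₀]
  simp

/-! ### Local form of the coefficients near a zero or a pole -/

theorem HasFDerivAt.dbar_eq {u : ℂ → ℂ} {L : ℂ →L[ℝ] ℂ} {z : ℂ} (h : HasFDerivAt u L z) :
    dbar u z = L 1 + I * L I := by
  rw [dbar, h.fderiv]

theorem DifferentiableAt.dbar_eq_zero {u : ℂ → ℂ} {z : ℂ} (h : DifferentiableAt ℂ u z) :
    dbar u z = 0 := by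
  rw [h.hasDerivAt.hasFDerivAt.restrictScalars ℝ |>.dbar_eq]
  simp
  rw [← mul_assoc, I_mul_I]
  ring

theorem dbar_sub {u v : ℂ → ℂ} {z : ℂ} (hu : DifferentiableAt ℝ u z)
    (hv : DifferentiableAt ℝ v z) : dbar (fun w => u w - v w) z = dbar u z - dbar v z := by
  rw [(hu.hasFDerivAt.fun_sub hv.hasFDerivAt).dbar_eq, dbar, dbar]
  simp
  ring

theorem dbar_neg (u : ℂ → ℂ) (z : ℂ) : dbar (fun w => -u w) z = -dbar u z := by
  rw [dbar, dbar, fderiv_fun_neg]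
  simp
  ring

theorem one_add_mul_conj_ne_zero (w : ℂ) : 1 + w * conj w ≠ 0 := by
  rw [mul_conj]
  have : (0 : ℝ) < 1 + normSq w := by linarith [normSq_nonneg w]
  exact_mod_cast this.ne'

/-- The coefficient of `dz` in `k̄ dk / (1 + k k̄)`. -/
noncomputable def poleCoeff (k : ℂ → ℂ) (z : ℂ) : ℂ :=
  deriv k z * conj (k z) / (1 + k z * conj (k z))

/-- The coefficient of `dz` in `dk / (k (1 + k k̄))`. -/
noncomputable def zeroCoeff (k : ℂ → ℂ) (z : ℂ) : ℂ :=
  deriv k z / (k z * (1 + k z * conj (k z)))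

/-- The coefficient of `dz̄ ∧ dz` in `dk̄ ∧ dk / (1 + k k̄)²`. -/
noncomputable def sphericalDensity (k : ℂ → ℂ) (z : ℂ) : ℂ :=
  conj (deriv k z) * deriv k z / (1 + k z * conj (k z)) ^ 2

theorem contDiffAt_poleCoeff {k : ℂ → ℂ} {z : ℂ} (hk : AnalyticAt ℂ k z) :
    ContDiffAt ℝ 1 (poleCoeff k) z := by
  have h1 : ContDiffAt ℝ 1 k z := (hk.contDiffAt (n := 1)).restrict_scalars ℝ
  have h2 : ContDiffAt ℝ 1 (deriv k) z := (hk.deriv.contDiffAt (n := 1)).restrict_scalars ℝ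
  have h3 : ContDiffAt ℝ 1 (fun w => conj (k w)) z :=
    (conjCLE.contDiff.contDiffAt).comp z h1
  have h4 := (contDiffAt_const (c := (1 : ℂ))).add (h1.mul h3)
  exact (h2.mul h3).mul (h4.inv (one_add_mul_conj_ne_zero _))

/-- `k` and `k'` are killed by `dbar`, so only `k̄` is differentiated, and `dbar k̄ = 2 conj k'`;
the factor `2` reflects the normalization of `dbar`. -/
theorem dbar_poleCoeff {k : ℂ → ℂ} {z : ℂ} (hk : AnalyticAt ℂ k z) :
    dbar (poleCoeff k) z = 2 * sphericalDensity k z := by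
  have h1 : HasFDerivAt k _ z := hk.differentiableAt.hasDerivAt.hasFDerivAt.restrictScalars ℝ
  have h2 : HasFDerivAt (deriv k) _ z :=
    hk.deriv.differentiableAt.hasDerivAt.hasFDerivAt.restrictScalars ℝ
  have h3 : HasFDerivAt (fun w => conj (k w)) _ z := (conjCLE.hasFDerivAt).comp z h1
  have hne := one_add_mul_conj_ne_zero (k z)
  have h4 := (h1.fun_mul h3).const_add 1
  have h5 := (h2.fun_mul h3).fun_mul ((hasFDerivAt_inv (𝕜 := ℂ) hne).restrictScalars ℝ |>.comp z h4)
  have h6 := h5.dbar_eq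
  have : poleCoeff k = fun w => deriv k w * conj (k w) * (Inv.inv ∘ fun w => (1 + k w * conj (k w))) w := by
    ext w
    simp [poleCoeff, div_eq_mul_inv]
  rw [this, h6, sphericalDensity]
  simp
  field_simp
  ring_nf
  simp only [I_sq]
  ring

/-- Write `g = (z - z₀)^n h` with `h z₀ ≠ 0`. If `n ≥ 0`, partial fractions give `g'/g` minus the
pole coefficient. If `n < 0`, the coefficient is minus the pole coefficient of `k = 1/g`, which is
holomorphic. In both cases `s` is built from the holomorphic extension, so it is C¹ at `z₀` whatever
the value `g z₀`. -/
theorem exists_local_form {g : ℂ → ℂ} {z₀ : ℂ} (hg : MeromorphicAt g z₀)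
    (h0 : meromorphicOrderAt g z₀ ≠ ⊤) :
    ∃ r > 0, ∃ s : ℂ → ℂ, ContDiffOn ℝ 1 s (Metric.ball z₀ r) ∧
      ∀ z ∈ Metric.ball z₀ r, z ≠ z₀ → AnalyticAt ℂ g z ∧ g z ≠ 0 ∧
        zeroCoeff g z = (meromorphicOrderAt g z₀).untop₀.toNat * (z - z₀)⁻¹ + s z ∧
        dbar s z = -2 * sphericalDensity g z := by
  obtain ⟨h, hh, hh0, hgh⟩ := (meromorphicOrderAt_ne_top_iff hg).1 h0
  generalize (meromorphicOrderAt g z₀).untop₀ = n at *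
  rw [EventuallyEq, eventually_nhdsWithin_iff] at hgh
  obtain ⟨r, hr, H⟩ := Metric.eventually_nhds_iff_ball.1
    ((hh.eventually_analyticAt.and (hh.continuousAt.eventually_ne hh0)).and hgh)
  refine ⟨r, hr, ?_⟩
  have hnhds : ∀ z ∈ Metric.ball z₀ r, z ≠ z₀ →
      g =ᶠ[𝓝 z] fun w => (w - z₀) ^ n • h w := fun z hz hne => by
    filter_upwards [Metric.isOpen_ball.mem_nhds hz, isOpen_ne.mem_nhds hne] with w hw hw'
    exact (H w hw).2 hw'
  rcases le_or_gt 0 n with hn | hn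
  · lift n to ℕ using hn
    set k : ℂ → ℂ := fun w => (w - z₀) ^ n * h w with hk
    have hka : ∀ z ∈ Metric.ball z₀ r, AnalyticAt ℂ k z := fun z hz =>
      ((analyticAt_id.sub analyticAt_const).pow n).mul (H z hz).1.1
    have hla : ∀ z ∈ Metric.ball z₀ r, AnalyticAt ℂ (fun w => deriv h w / h w) z := fun z hz =>
      (H z hz).1.1.deriv.div (H z hz).1.1 (H z hz).1.2
    have hlr : ∀ z ∈ Metric.ball z₀ r, ContDiffAt ℝ 1 (fun w => deriv h w / h w) z := fun z hz =>
      ((hla z hz).contDiffAt (n := 1)).restrict_scalars ℝ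
    refine ⟨fun w => deriv h w / h w - poleCoeff k w, fun z hz =>
      ((hlr z hz).sub (contDiffAt_poleCoeff (hka z hz))).contDiffWithinAt, fun z hz hne => ?_⟩
    have hgk : g =ᶠ[𝓝 z] k := by simpa [hk] using hnhds z hz hne
    have hw : z - z₀ ≠ 0 := sub_ne_zero.2 hne
    have hhz := (H z hz).1.2
    have hkz : k z ≠ 0 := mul_ne_zero (pow_ne_zero _ hw) hhz
    refine ⟨(hka z hz).congr hgk.symm, by rw [hgk.self_of_nhds]; exact hkz, ?_, ?_⟩
    · have hdk : deriv k z / k z = n * (z - z₀)⁻¹ + deriv h z / h z := by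
        have h1 : HasDerivAt k (n * (z - z₀) ^ (n - 1) * 1 * h z + (z - z₀) ^ n * deriv h z) z :=
          (((hasDerivAt_id z).sub_const z₀).pow n).mul (H z hz).1.1.differentiableAt.hasDerivAt
        -- The exponent is truncated at `n = 0`, where the factor `n` makes both sides vanish.
        have h2 : (n : ℂ) * (z - z₀) ^ (n - 1) = n * (z - z₀) ^ n * (z - z₀)⁻¹ := by
          rcases n with _ | n
          · simp
          · simp [pow_succ]
            field_simp
        rw [h1.deriv, h2, hk]
        have := pow_ne_zero n hw
        field_simp
      have hne := one_add_mul_conj_ne_zero (k z)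
      rw [zeroCoeff, hgk.deriv_eq, hgk.self_of_nhds, Int.toNat_natCast]
      beta_reduce
      rw [poleCoeff, ← add_sub_assoc, ← hdk]
      field_simp
      ring
    · rw [dbar_sub ((hlr z hz).differentiableAt one_ne_zero)
        ((contDiffAt_poleCoeff (hka z hz)).differentiableAt one_ne_zero),
        (hla z hz).differentiableAt.dbar_eq_zero, dbar_poleCoeff (hka z hz), sphericalDensity,
        sphericalDensity, hgk.deriv_eq, hgk.self_of_nhds]
      ring
  -- A pole of order `m + 1`: here `toNat` of the order is `0`, so no singular term is left.
  · obtain ⟨m, rfl⟩ := Int.eq_negSucc_of_lt_zero hn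
    set k : ℂ → ℂ := fun w => (w - z₀) ^ (m + 1) * (h w)⁻¹ with hk
    have hka : ∀ z ∈ Metric.ball z₀ r, AnalyticAt ℂ k z := fun z hz =>
      ((analyticAt_id.sub analyticAt_const).pow (m + 1)).mul ((H z hz).1.1.inv (H z hz).1.2)
    refine ⟨fun w => -poleCoeff k w, fun z hz =>
      (contDiffAt_poleCoeff (hka z hz)).neg.contDiffWithinAt, fun z hz hne => ?_⟩
    have hgk : g =ᶠ[𝓝 z] fun w => (k w)⁻¹ := by
      simpa [hk, zpow_negSucc, mul_comm] using hnhds z hz hne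
    have hw : z - z₀ ≠ 0 := sub_ne_zero.2 hne
    have hhz := (H z hz).1.2
    have hkz : k z ≠ 0 := mul_ne_zero (pow_ne_zero _ hw) (inv_ne_zero hhz)
    have hd : deriv g z = -deriv k z / k z ^ 2 := by
      rw [hgk.deriv_eq]
      exact ((hka z hz).differentiableAt.hasDerivAt.inv hkz).deriv
    have hne1 := one_add_mul_conj_ne_zero (k z)
    have hne2 := one_add_mul_conj_ne_zero (k z)⁻¹
    have hck : conj (k z) ≠ 0 := (map_ne_zero _).2 hkz
    refine ⟨((hka z hz).inv hkz).congr hgk.symm, by rw [hgk.self_of_nhds]; exact inv_ne_zero hkz,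
      ?_, ?_⟩
    · rw [zeroCoeff, hd, hgk.self_of_nhds]
      beta_reduce
      rw [poleCoeff]
      rw [map_inv₀] at hne2 ⊢
      have : 1 + (k z)⁻¹ * (conj (k z))⁻¹ = (1 + k z * conj (k z)) / (k z * conj (k z)) := by
        field_simp
        ring
      rw [this]
      simp
      field_simp
    · rw [dbar_neg, dbar_poleCoeff (hka z hz), sphericalDensity, sphericalDensity, hd,
        hgk.self_of_nhds]
      rw [map_inv₀]
      have : 1 + (k z)⁻¹ * (conj (k z))⁻¹ = (1 + k z * conj (k z)) / (k z * conj (k z)) := by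
        field_simp
        ring
      rw [this]
      simp
      field_simp

/-! ### Integration by parts and the residue formula in the plane -/

theorem integrable_mul_of_continuousOn {s φ : ℂ → ℂ} {U : Set ℂ}
    (hs : ContinuousOn s U) (hφ : Continuous φ) (hc : HasCompactSupport φ)
    (hsub : tsupport φ ⊆ U) : Integrable (fun z => s z * φ z) := by
  have h1 : IntegrableOn (fun z => s z * φ z) (tsupport φ) :=
    ((hs.mono hsub).mul hφ.continuousOn).integrableOn_compact hc
  refine (integrableOn_iff_integrable_of_support_subset fun z hz => ?_).1 h1
  exact subset_tsupport _ (right_ne_zero_of_mul hz)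

/-- Integration by parts for `∂/∂z̄`. -/
theorem integral_mul_dbar {s ψ : ℂ → ℂ} {U : Set ℂ} (hU : IsOpen U) (hs : ContDiffOn ℝ 1 s U)
    (hψ : ContDiff ℝ 1 ψ) (hc : HasCompactSupport ψ) (hsub : tsupport ψ ⊆ U) :
    ∫ z, s z * dbar ψ z = -∫ z, dbar s z * ψ z := by
  have hs' : ContinuousOn (fderiv ℝ s) U := hs.continuousOn_fderiv_of_isOpen hU le_rfl
  have hψ' := hψ.continuous_fderiv one_ne_zero
  have hi1 : ∀ v : ℂ, Integrable (fun z => fderiv ℝ s z v * ψ z) := fun v =>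
    integrable_mul_of_continuousOn (U := U) (by fun_prop) hψ.continuous hc hsub
  have hi2 : ∀ v : ℂ, Integrable (fun z => s z * fderiv ℝ ψ z v) := fun v =>
    integrable_mul_of_continuousOn hs.continuousOn (φ := fun z => fderiv ℝ ψ z v) (by fun_prop)
      (hc.fderiv_apply ℝ v) ((tsupport_fderiv_apply_subset ℝ v).trans hsub)
  have key : ∀ v : ℂ, ∫ z, s z * fderiv ℝ ψ z v = -∫ z, fderiv ℝ s z v * ψ z := fun v =>
    integral_mul_fderiv_eq_neg_fderiv_mul_of_integrable (hi1 v) (hi2 v)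
      (integrable_mul_of_continuousOn hs.continuousOn hψ.continuous hc hsub)
      (fun z hz => (hs.contDiffAt (hU.mem_nhds (hsub hz))).differentiableAt one_ne_zero)
      (fun z _ => hψ.differentiable one_ne_zero z)
  have e1 : ∀ z, s z * dbar ψ z = s z * fderiv ℝ ψ z 1 + I * (s z * fderiv ℝ ψ z I) := fun z => by
    rw [dbar]; ring
  have e2 : ∀ z, dbar s z * ψ z = fderiv ℝ s z 1 * ψ z + I * (fderiv ℝ s z I * ψ z) := fun z => by
    rw [dbar]; ring
  simp_rw [e1, e2]
  rw [integral_add (hi2 1) ((hi2 I).const_mul I), integral_add (hi1 1) ((hi1 I).const_mul I),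
    integral_const_mul, integral_const_mul, key, key]
  ring

/-- The residue formula for `dg / (g (1 + g ḡ))` tested on a function supported near `z₀`. -/
theorem integral_zeroCoeff_mul_dbar {g s ψ : ℂ → ℂ} {z₀ : ℂ} {r : ℝ} {m : ℂ}
    (hs : ContDiffOn ℝ 1 s (Metric.ball z₀ r))
    (h : ∀ z ∈ Metric.ball z₀ r, z ≠ z₀ → zeroCoeff g z = m * (z - z₀)⁻¹ + s z ∧
      dbar s z = -2 * sphericalDensity g z)
    (hψ : ContDiff ℝ 1 ψ) (hc : HasCompactSupport ψ) (hsub : tsupport ψ ⊆ Metric.ball z₀ r) :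
    ∫ z, (ψ z * (2 * sphericalDensity g z) - zeroCoeff g z * dbar ψ z)
      = 2 * Real.pi * m * ψ z₀ := by
  have hs' : ContinuousOn (fderiv ℝ s) (Metric.ball z₀ r) :=
    hs.continuousOn_fderiv_of_isOpen Metric.isOpen_ball le_rfl
  have i1 : Integrable (fun z => dbar s z * ψ z) :=
    integrable_mul_of_continuousOn (U := Metric.ball z₀ r) (by unfold dbar; fun_prop)
      hψ.continuous hc hsub
  have i2 : Integrable (fun z => s z * dbar ψ z) :=
    integrable_mul_of_continuousOn hs.continuousOn (continuous_dbar hψ)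
      (hc.mono' (support_dbar_subset ψ)) ((tsupport_dbar_subset ψ).trans hsub)
  have i3 : Integrable (fun z => (z - z₀)⁻¹ * dbar ψ z) := by
    have := (locallyIntegrable_inv_sub z₀).integrable_smul_right_of_hasCompactSupport
      (continuous_dbar hψ) (hc.mono' (support_dbar_subset ψ))
    simpa [smul_eq_mul] using this
  have hae : ∀ᵐ z : ℂ, z ≠ z₀ := by
    simp [ae_iff]
  -- After substituting the local form, the part containing `s` is minus `dbar (s ψ)` and integrates
  -- to zero; Cauchy–Pompeiu evaluates the rest.
  have : ∫ z, (ψ z * (2 * sphericalDensity g z) - zeroCoeff g z * dbar ψ z)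
      = ∫ z, (-(dbar s z * ψ z + s z * dbar ψ z) - m * ((z - z₀)⁻¹ * dbar ψ z)) := by
    refine integral_congr_ae ?_
    filter_upwards [hae] with z hz
    by_cases hzb : z ∈ Metric.ball z₀ r
    · rw [(h z hzb hz).1, (h z hzb hz).2]
      ring
    · have h1 : ψ z = 0 := image_eq_zero_of_notMem_tsupport fun hh => hzb (hsub hh)
      have h2 : dbar ψ z = 0 := image_eq_zero_of_notMem_tsupport
        fun hh => hzb (hsub (tsupport_dbar_subset ψ hh))
      simp [h1, h2]
  rw [this, integral_sub (by exact (i1.add i2).neg) (i3.const_mul m), integral_neg, integral_add i1 i2,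
    integral_mul_dbar Metric.isOpen_ball hs hψ hc hsub, integral_const_mul,
    integral_inv_sub_mul_dbar hψ hc]
  ring

namespace RiemannSurface

/-! ### Coefficients of forms and change of charts -/

section Coefficients

variable {M : Type*} [TopologicalSpace M]

/-- Finite sets are null in every chart, which allows zeros and poles to be ignored under integrals.
-/
theorem ae_restrict_target_of_finite {S : Set M} (hS : S.Finite) (e : OpenPartialHomeomorph M ℂ) :
    ∀ᵐ z ∂(volume.restrict e.target), e.symm z ∉ S := by
  rw [ae_restrict_iff' e.open_target.measurableSet]
  have : (e '' S).Finite := hS.image e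
  have h0 : volume (e '' S) = 0 := this.measure_zero _
  filter_upwards [measure_eq_zero_iff_ae_notMem.1 h0] with z hz hzt hzS
  exact hz ⟨e.symm z, hzS, e.right_inv hzt⟩

variable [ChartedSpace ℂ M]

theorem coeffTwo_smul (e : OpenPartialHomeomorph M ℂ) (χ : M → ℂ) (Ω : TwoForm M) (z : ℂ) :
    coeffTwo e (fun p => χ p • Ω p) z = χ (e.symm z) * coeffTwo e Ω z := rfl

theorem coeffTwo_wedge (e : OpenPartialHomeomorph M ℂ) (α β : OneForm M) (z : ℂ) :
    coeffTwo e (wedge α β) z =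
      coeffOne e α 1 z * coeffOne e β I z - coeffOne e α I z * coeffOne e β 1 z := by
  rw [coeffTwo, wedge_apply]
  rfl

theorem coeffTwo_eq_zero {e : OpenPartialHomeomorph M ℂ} {Ω : TwoForm M} {z : ℂ}
    (h : Ω (e.symm z) = 0) : coeffTwo e Ω z = 0 := by
  rw [coeffTwo, h]
  rfl

theorem finite_support_partitionOfUnity [CompactSpace M]
    (ρ : SmoothPartitionOfUnity M 𝓘(ℝ, ℂ) M univ) :
    {p | ρ p ≠ 0}.Finite := by
  refine (ρ.locallyFinite.finite_nonempty_of_compact).subset fun p hp => ?_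
  by_contra h
  apply hp
  rw [mem_ofPred_eq, Function.support_nonempty_iff, not_not] at h
  ext q
  exact congrFun h q

end Coefficients

section Charts

variable {M : Type*} [TopologicalSpace M] [ChartedSpace ℂ M] [IsManifold 𝓘(ℂ) ω M]

theorem analyticAt_transition {e e' : OpenPartialHomeomorph M ℂ} (he : e ∈ atlas ℂ M)
    (he' : e' ∈ atlas ℂ M) {z : ℂ} (hz : z ∈ e.target) (hz' : e.symm z ∈ e'.source) :
    AnalyticAt ℂ (e' ∘ e.symm) z := by
  have h := (mem_groupoid_of_pregroupoid.mp
    (HasGroupoid.compatible (G := contDiffGroupoid ω 𝓘(ℂ)) he he')).1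
  have h' : ContDiffOn ℂ ω (e.symm.trans e') (e.symm.trans e').source := by
    simpa [contDiffPregroupoid] using h
  have hmem : z ∈ (e.symm.trans e').source := by simp [hz, hz']
  exact ContDiffAt.analyticAt
    (h'.contDiffAt ((e.symm.trans e').open_source.mem_nhds hmem))

/-- Chain rule: composing with the reverse transition gives the identity near `z`. -/
theorem deriv_transition_ne_zero {e e' : OpenPartialHomeomorph M ℂ} (he : e ∈ atlas ℂ M)
    (he' : e' ∈ atlas ℂ M) {z : ℂ} (hz : z ∈ e.target) (hz' : e.symm z ∈ e'.source) :
    deriv (e' ∘ e.symm) z ≠ 0 := by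
  have hw : e' (e.symm z) ∈ e'.target := e'.map_source hz'
  have hw' : e'.symm (e' (e.symm z)) = e.symm z := e'.left_inv hz'
  have h1 := (analyticAt_transition he he' hz hz').differentiableAt.hasDerivAt
  have h2 : HasDerivAt (e ∘ e'.symm) _ ((e' ∘ e.symm) z) :=
    (analyticAt_transition he' he hw
      (by rw [hw']; exact e.map_target hz)).differentiableAt.hasDerivAt
  have h3 := h2.comp z h1
  have h4 : (e ∘ e'.symm) ∘ (e' ∘ e.symm) =ᶠ[𝓝 z] id := by
    have hopen := (e.symm.trans e').open_source
    have hmem : z ∈ (e.symm.trans e').source := by simp [hz, hz']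
    filter_upwards [hopen.mem_nhds hmem] with w hw
    have hw1 : w ∈ e.target := by simpa using hw.1
    have hw2 : e.symm w ∈ e'.source := hw.2
    simp [e'.left_inv hw2, e.right_inv hw1]
  have h5 := (h3.congr_of_eventuallyEq h4.symm).unique (hasDerivAt_id z)
  exact right_ne_zero_of_mul (by rw [h5]; exact one_ne_zero)

theorem mdifferentiableAt_symm {e : OpenPartialHomeomorph M ℂ} (he : e ∈ atlas ℂ M) {z : ℂ}
    (hz : z ∈ e.target) : MDifferentiableAt 𝓘(ℝ, ℂ) 𝓘(ℝ, ℂ) e.symm z := by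
  have := isManifold_real M
  have : IsManifold 𝓘(ℝ, ℂ) 1 M := IsManifold.of_le (n := ∞) (by norm_cast)
  exact mdifferentiableAt_atlas_symm he hz

theorem mdifferentiableAt_chart {e : OpenPartialHomeomorph M ℂ} (he : e ∈ atlas ℂ M) {p : M}
    (hp : p ∈ e.source) : MDifferentiableAt 𝓘(ℝ, ℂ) 𝓘(ℝ, ℂ) e p := by
  have := isManifold_real M
  have : IsManifold 𝓘(ℝ, ℂ) 1 M := IsManifold.of_le (n := ∞) (by norm_cast)
  exact mdifferentiableAt_atlas he hp

theorem mdifferentiableAt_of_comp_symm {e : OpenPartialHomeomorph M ℂ} (he : e ∈ atlas ℂ M)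
    {f : M → ℂ} {z : ℂ} (hz : z ∈ e.target) (hf : DifferentiableAt ℝ (f ∘ e.symm) z) :
    MDifferentiableAt 𝓘(ℝ, ℂ) 𝓘(ℝ, ℂ) f (e.symm z) := by
  have h1 : MDifferentiableAt 𝓘(ℝ, ℂ) 𝓘(ℝ, ℂ) (f ∘ e.symm) (e (e.symm z)) := by
    rw [e.right_inv hz]
    exact hf.mdifferentiableAt
  have h2 := h1.comp (e.symm z) (mdifferentiableAt_chart he (e.map_target hz))
  refine h2.congr_of_eventuallyEq ?_
  filter_upwards [e.open_source.mem_nhds (e.map_target hz)] with q hq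
  simp [e.left_inv hq]

theorem coeffOne_d {e : OpenPartialHomeomorph M ℂ} (he : e ∈ atlas ℂ M)
    {f : M → ℂ} {z : ℂ} (hz : z ∈ e.target) (hf : DifferentiableAt ℝ (f ∘ e.symm) z) (v : ℂ) :
    coeffOne e (d f) v z = fderiv ℝ (f ∘ e.symm) z v := by
  have h := mfderiv_comp z (mdifferentiableAt_of_comp_symm he hz hf) (mdifferentiableAt_symm he hz)
  rw [mfderiv_eq_fderiv] at h
  rw [h]
  rfl

/-- The two base points are equal only through `e'.left_inv`, so the tangent vectors are compared in
the model space `ℂ`. -/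
theorem coordVec_transition {e e' : OpenPartialHomeomorph M ℂ} (he : e ∈ atlas ℂ M)
    (he' : e' ∈ atlas ℂ M) {z : ℂ} (hz : z ∈ e.target) (hz' : e.symm z ∈ e'.source) (v : ℂ) :
    @Eq ℂ (coordVec e z v) (coordVec e' (e' (e.symm z)) (deriv (e' ∘ e.symm) z * v)) := by
  have ha := analyticAt_transition he he' hz hz'
  have hd : HasFDerivAt (e' ∘ e.symm) _ z :=
    ha.differentiableAt.hasDerivAt.hasFDerivAt.restrictScalars ℝ
  have h1 := mfderiv_comp z
    (mdifferentiableAt_symm he' (z := (e' ∘ e.symm) z) (e'.map_source hz'))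
    hd.differentiableAt.mdifferentiableAt
  have h2 : e'.symm ∘ (e' ∘ e.symm) =ᶠ[𝓝 z] e.symm := by
    have hopen := (e.symm.trans e').open_source
    have hmem : z ∈ (e.symm.trans e').source := by simp [hz, hz']
    filter_upwards [hopen.mem_nhds hmem] with w hw
    have hw2 : e.symm w ∈ e'.source := hw.2
    simp [e'.left_inv hw2]
  have h3 := h2.mfderiv_eq (I := 𝓘(ℝ, ℂ)) (I' := 𝓘(ℝ, ℂ))
  rw [h1, mfderiv_eq_fderiv, hd.fderiv] at h3
  have h4 := congrArg (fun L : ℂ →L[ℝ] ℂ => L v) h3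
  simp only [coordVec]
  rw [mul_comm]
  exact h4.symm

/-- An alternating form scales by the determinant, and multiplication by `w` on `ℝ²` has determinant
`|w|²`. -/
theorem alternating_rotate (A : ℂ [⋀^Fin 2]→L[ℝ] ℂ) (L : ℂ →L[ℝ] ℂ) (w : ℂ) :
    A ![L (w * 1), L (w * I)] = (normSq w : ℂ) * A ![L 1, L I] := by
  have hr : ∀ u x y : ℂ, ∀ a b : ℝ,
      A ![u, a • x + b • y] = a • A ![u, x] + b • A ![u, y] := by
    intro u x y a b
    have h1 : ∀ t : ℂ, ![u, t] = Function.update ![u, 0] 1 t := by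
      intro t; ext i; fin_cases i <;> rfl
    rw [h1, h1 x, h1 y, A.map_update_add, A.map_update_smul, A.map_update_smul]
  have hl : ∀ u x y : ℂ, ∀ a b : ℝ,
      A ![a • x + b • y, u] = a • A ![x, u] + b • A ![y, u] := by
    intro u x y a b
    have h1 : ∀ t : ℂ, ![t, u] = Function.update ![0, u] 0 t := by
      intro t; ext i; fin_cases i <;> rfl
    rw [h1, h1 x, h1 y, A.map_update_add, A.map_update_smul, A.map_update_smul]
  have hs : ∀ x : ℂ, A ![x, x] = 0 := fun x =>
    A.map_eq_zero_of_eq ![x, x] (i := 0) (j := 1) rfl (by decide)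
  have hsw : ∀ x y : ℂ, A ![y, x] = -A ![x, y] := by
    intro x y
    have h := hs ((1 : ℝ) • x + (1 : ℝ) • y)
    rw [hl, hr, hr, hs, hs] at h
    simp only [one_smul, zero_add, add_zero] at h
    exact eq_neg_of_add_eq_zero_right h
  have e1 : w * 1 = w.re • (1 : ℂ) + w.im • I := by simp
  have e2 : w * I = (-w.im) • (1 : ℂ) + w.re • I := by
    apply Complex.ext <;> simp
  rw [e1, e2, map_add, map_add, map_smul, map_smul, map_smul, map_smul, hl, hr, hr, hs, hs,
    hsw (L 1) (L I), normSq_apply]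
  simp only [real_smul]
  push_cast
  ring

theorem coeffTwo_transition {e e' : OpenPartialHomeomorph M ℂ} (he : e ∈ atlas ℂ M)
    (he' : e' ∈ atlas ℂ M) {z : ℂ} (hz : z ∈ e.target) (hz' : e.symm z ∈ e'.source)
    (Ω : TwoForm M) : coeffTwo e Ω z =
      (normSq (deriv (e' ∘ e.symm) z) : ℂ) * coeffTwo e' Ω (e' (e.symm z)) := by
  have h := fun v => coordVec_transition he he' hz hz' v
  have hΩ : ∀ p q : M, p = q → ∀ u v : ℂ,
      (Ω p : ℂ [⋀^Fin 2]→L[ℝ] ℂ) ![u, v] = (Ω q : ℂ [⋀^Fin 2]→L[ℝ] ℂ) ![u, v] := by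
    rintro p _ rfl u v
    rfl
  have h1 : coeffTwo e Ω z = (Ω (e'.symm (e' (e.symm z))) : ℂ [⋀^Fin 2]→L[ℝ] ℂ)
      ![coordVec e' (e' (e.symm z)) (deriv (e' ∘ e.symm) z * 1),
        coordVec e' (e' (e.symm z)) (deriv (e' ∘ e.symm) z * I)] := by
    rw [← h 1, ← h I]
    exact hΩ _ _ (e'.left_inv hz').symm _ _
  rw [h1]
  exact alternating_rotate _ (mfderiv 𝓘(ℝ, ℂ) 𝓘(ℝ, ℂ) e'.symm (e' (e.symm z))) _

theorem det_restrictScalars_mul (w : ℂ) :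
    ((ContinuousLinearMap.toSpanSingleton ℂ w : ℂ →L[ℂ] ℂ).restrictScalars ℝ).det = normSq w := by
  have : (((ContinuousLinearMap.toSpanSingleton ℂ w : ℂ →L[ℂ] ℂ).restrictScalars ℝ : ℂ →L[ℝ] ℂ) :
      ℂ →ₗ[ℝ] ℂ) = Algebra.lmul ℝ ℂ w := by
    ext; simp [mul_comm]
  rw [ContinuousLinearMap.det, this, ← Algebra.norm_apply, Algebra.norm_complex_apply]

/-- The factor `|τ'|²` by which the coefficient changes is the real Jacobian of the holomorphic
transition `τ`. It is nonnegative, so the absolute value in the change of variables is harmless. -/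
theorem setIntegral_coeffTwo_transition {e e' : OpenPartialHomeomorph M ℂ} (he : e ∈ atlas ℂ M)
    (he' : e' ∈ atlas ℂ M) (Ω : TwoForm M) :
    ∫ z in e.target ∩ e.symm ⁻¹' e'.source, coeffTwo e Ω z
      = ∫ z in e'.target ∩ e'.symm ⁻¹' e.source, coeffTwo e' Ω z := by
  have hs : (e.symm.trans e').source = e.target ∩ e.symm ⁻¹' e'.source := by simp
  have ht : (e.symm.trans e').target = e'.target ∩ e'.symm ⁻¹' e.source := by simp
  rw [← hs, ← ht, integral_target_eq_integral_abs_det_fderiv_smul volume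
    (f' := fun z => (ContinuousLinearMap.toSpanSingleton ℂ
      (deriv (e' ∘ e.symm) z)).restrictScalars ℝ)]
  · refine setIntegral_congr_fun (e.symm.trans e').open_source.measurableSet fun z hz => ?_
    rw [hs] at hz
    simp only [det_restrictScalars_mul, abs_of_nonneg (normSq_nonneg _), real_smul]
    exact coeffTwo_transition he he' hz.1 hz.2 Ω
  · intro z hz
    rw [hs] at hz
    exact (analyticAt_transition he he' hz.1
      hz.2).differentiableAt.hasDerivAt.hasFDerivAt.restrictScalars ℝ

theorem setIntegral_chart_eq {e e' : OpenPartialHomeomorph M ℂ} (he : e ∈ atlas ℂ M)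
    (he' : e' ∈ atlas ℂ M) {Ω : TwoForm M} (h : ∀ p, p ∉ e.source ∩ e'.source → Ω p = 0) :
    ∫ z in e.target, coeffTwo e Ω z = ∫ z in e'.target, coeffTwo e' Ω z := by
  have h1 := setIntegral_coeffTwo_transition he he' Ω
  rw [← setIntegral_eq_of_subset_of_forall_sdiff_eq_zero e.open_target.measurableSet
    inter_subset_left, ← setIntegral_eq_of_subset_of_forall_sdiff_eq_zero
    e'.open_target.measurableSet inter_subset_left] at h1
  · exact h1
  · intro z hz
    refine coeffTwo_eq_zero (h _ fun hh => hz.2 ⟨hz.1, hh.1⟩)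
  · intro z hz
    refine coeffTwo_eq_zero (h _ fun hh => hz.2 ⟨hz.1, hh.2⟩)

end Charts

/-! ### The integral of two-forms on the surface -/

section Integral

variable {M : Type*} [TopologicalSpace M] [ChartedSpace ℂ M] [IsManifold 𝓘(ℂ) ω M]
  [T2Space M] [CompactSpace M]

theorem integral_eq_finsetSum {s : Finset M} (hs : ∀ p, partitionOfUnity M p ≠ 0 → p ∈ s)
    (Ω : TwoForm M) :
    integral Ω = ∑ p ∈ s, ∫ z in (chartAt ℂ p).target,
      ((partitionOfUnity M p ((chartAt ℂ p).symm z) : ℝ) : ℂ) * coeffTwo (chartAt ℂ p) Ω z := by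
  refine finsum_eq_sum_of_support_subset _ fun p hp => hs p fun h => hp ?_
  simp [h]

/-- The integral of a two-form supported in a coordinate domain is computed in that chart. -/
theorem integral_eq_setIntegral_chart {e : OpenPartialHomeomorph M ℂ} (he : e ∈ atlas ℂ M)
    {Ω : TwoForm M} (h : ∀ p ∉ e.source, Ω p = 0) (hi : IntegrableOn (coeffTwo e Ω) e.target) :
    integral Ω = ∫ z in e.target, coeffTwo e Ω z := by
  set ρ := partitionOfUnity M with hρ
  have hfin := finite_support_partitionOfUnity ρ
  rw [integral_eq_finsetSum (s := hfin.toFinset) (by simp [hρ])]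
  -- `ρ p • Ω` vanishes off the overlap of the two chart domains, so each summand moves to `e`,
  -- where the `ρ p` sum to `1`.
  have h1 : ∀ p, ∫ z in (chartAt ℂ p).target, ((ρ p ((chartAt ℂ p).symm z) : ℝ) : ℂ) *
      coeffTwo (chartAt ℂ p) Ω z = ∫ z in e.target, ((ρ p (e.symm z) : ℝ) : ℂ) * coeffTwo e Ω z := by
    intro p
    refine setIntegral_chart_eq (Ω := fun q => ((ρ p q : ℝ) : ℂ) • Ω q) (chart_mem_atlas ℂ p) he ?_
    intro q hq
    by_cases hqe : q ∈ e.source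
    · have : ρ p q = 0 := image_eq_zero_of_notMem_tsupport fun hh =>
        hq ⟨partitionOfUnity_isSubordinate p hh, hqe⟩
      simp only [this, ofReal_zero]
      exact zero_smul ℂ (Ω q)
    · simp only [h q hqe]
      exact smul_zero (M := ℂ) (A := ℂ [⋀^Fin 2]→L[ℝ] ℂ) (ρ p q : ℂ)
  rw [Finset.sum_congr rfl fun p _ => h1 p, ← integral_finsetSum]
  · refine setIntegral_congr_fun e.open_target.measurableSet fun z _ => ?_
    have h2 : ∑ p ∈ hfin.toFinset, ρ p (e.symm z) = 1 := by
      rw [← ρ.sum_eq_one (mem_univ (e.symm z))]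
      refine (finsum_eq_sum_of_support_subset _ fun p hp => ?_).symm
      simp only [Finite.coe_toFinset, mem_ofPred_eq]
      intro h
      apply hp
      simp [h]
    rw [← Finset.sum_mul, ← ofReal_sum, h2]
    simp
  · intro p _
    refine hi.bdd_mul (c := 1) ?_ (Eventually.of_forall fun z => ?_)
    · refine ContinuousOn.aestronglyMeasurable ?_ e.open_target.measurableSet
      exact continuous_ofReal.comp_continuousOn
        ((ρ p).contMDiff.continuous.comp_continuousOn e.continuousOn_symm)
    · rw [norm_real, Real.norm_of_nonneg (ρ.nonneg p _)]
      exact ρ.le_one p _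

/-- Local integrability controls only compact subsets of the chart target; the support of `ρ p` is
carried to one by the chart. -/
theorem integrableOn_partition_mul {Ω : TwoForm M} (hΩ : LocIntegrableTwo Ω) (p : M) :
    IntegrableOn (fun z => ((partitionOfUnity M p ((chartAt ℂ p).symm z) : ℝ) : ℂ) *
      coeffTwo (chartAt ℂ p) Ω z) (chartAt ℂ p).target := by
  set ρ := partitionOfUnity M with hρ
  set e := chartAt ℂ p with he
  set K := e '' tsupport (ρ p) with hK
  have hsub : tsupport (ρ p) ⊆ e.source := partitionOfUnity_isSubordinate p
  have hKc : IsCompact K :=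
    (isClosed_tsupport _).isCompact.image_of_continuousOn (e.continuousOn.mono hsub)
  have hKt : K ⊆ e.target := by
    rintro _ ⟨q, hq, rfl⟩
    exact e.map_source (hsub hq)
  have h1 := (hΩ e (chart_mem_atlas ℂ p)).integrableOn_compact_subset hKt hKc
  have h2 : IntegrableOn (fun z => ((ρ p (e.symm z) : ℝ) : ℂ) * coeffTwo e Ω z) K := by
    refine h1.continuousOn_mul ?_ hKc
    exact (continuous_ofReal.comp_continuousOn
      ((ρ p).contMDiff.continuous.comp_continuousOn e.continuousOn_symm)).mono hKt
  refine h2.of_forall_sdiff_eq_zero e.open_target.measurableSet fun z hz => ?_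
  have : ρ p (e.symm z) = 0 := image_eq_zero_of_notMem_tsupport fun hh =>
    hz.2 ⟨e.symm z, hh, e.right_inv hz.1⟩
  simp [this]

theorem integral_finsetSum_twoForm {ι : Type*} (s : Finset ι) {Ω : ι → TwoForm M}
    (hΩ : ∀ i ∈ s, LocIntegrableTwo (Ω i)) :
    integral (fun p => ∑ i ∈ s, Ω i p) = ∑ i ∈ s, integral (Ω i) := by
  have hfin := finite_support_partitionOfUnity (partitionOfUnity M)
  simp_rw [integral_eq_finsetSum (s := hfin.toFinset) (by simp)]
  rw [Finset.sum_comm]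
  refine Finset.sum_congr rfl fun p _ => ?_
  rw [← integral_finsetSum _ fun i hi => integrableOn_partition_mul (hΩ i hi) p]
  refine integral_congr_ae (Eventually.of_forall fun z => ?_)
  have : coeffTwo (chartAt ℂ p) (fun q => ∑ i ∈ s, Ω i q) z
      = ∑ i ∈ s, coeffTwo (chartAt ℂ p) (Ω i) z := by
    simp [coeffTwo]
  beta_reduce
  rw [this, Finset.mul_sum]

theorem integral_twoForm_add {Ω Ω' : TwoForm M} (h : LocIntegrableTwo Ω) (h' : LocIntegrableTwo Ω') :
    integral (fun p => Ω p + Ω' p) = integral Ω + integral Ω' := by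
  have := integral_finsetSum_twoForm (Finset.univ : Finset Bool) (Ω := fun b => if b then Ω else Ω')
    (by rintro (_ | _) _ <;> simpa)
  simpa using this

theorem integral_congr_off_finite {S : Set M} (hS : S.Finite) {Ω Ω' : TwoForm M}
    (h : ∀ p ∉ S, Ω p = Ω' p) : integral Ω = integral Ω' := by
  refine finsum_congr fun p => integral_congr_ae ?_
  filter_upwards [ae_restrict_target_of_finite hS (chartAt ℂ p)] with z hz
  simp only [coeffTwo, h _ hz]

end Integral

end RiemannSurface

/-! ### Local integrability and regularity of meromorphic functions -/

/-- In the local form `1/(z - z₀)` is locally integrable and `s` is continuous; the density is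
almost everywhere `-1/2` times the continuous function `dbar s`. -/
theorem integrableAtFilter_zeroCoeff_and_sphericalDensity {g : ℂ → ℂ} {z₀ : ℂ}
    (hg : MeromorphicAt g z₀) (h0 : meromorphicOrderAt g z₀ ≠ ⊤) :
    IntegrableAtFilter (zeroCoeff g) (𝓝 z₀) ∧ IntegrableAtFilter (sphericalDensity g) (𝓝 z₀) := by
  obtain ⟨r, hr, s, hs, h⟩ := exists_local_form hg h0
  have hs' : ContinuousOn (fderiv ℝ s) (Metric.ball z₀ r) :=
    hs.continuousOn_fderiv_of_isOpen Metric.isOpen_ball le_rfl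
  have hsub : Metric.closedBall z₀ (r / 2) ⊆ Metric.ball z₀ r :=
    Metric.closedBall_subset_ball (by linarith)
  have hK : IsCompact (Metric.closedBall z₀ (r / 2)) := isCompact_closedBall _ _
  have hae : ∀ᵐ z ∂(volume.restrict (Metric.closedBall z₀ (r / 2))), z ∈ Metric.ball z₀ r ∧ z ≠ z₀ := by
    have h1 : ∀ᵐ z ∂(volume.restrict (Metric.closedBall z₀ (r / 2))), z ≠ z₀ :=
      ae_restrict_of_ae (by simp [ae_iff])
    filter_upwards [h1, ae_restrict_mem hK.measurableSet] with z hz hzb using ⟨hsub hzb, hz⟩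
  have hmem := Metric.closedBall_mem_nhds z₀ (half_pos hr)
  have hdb : ContinuousOn (dbar s) (Metric.ball z₀ r) := by unfold dbar; fun_prop
  refine ⟨⟨_, hmem, ?_⟩, ⟨_, hmem, ?_⟩⟩
  · have h1 : IntegrableOn (fun z => ((meromorphicOrderAt g z₀).untop₀.toNat : ℂ) * (z - z₀)⁻¹ + s z)
        (Metric.closedBall z₀ (r / 2)) :=
      (((locallyIntegrable_inv_sub z₀).integrableOn_isCompact hK).const_mul _).add
        ((hs.continuousOn.mono hsub).integrableOn_compact hK)
    refine Integrable.congr h1 ?_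
    filter_upwards [hae] with z hz using ((h z hz.1 hz.2).2.2.1).symm
  · have h1 : IntegrableOn (fun z => (-1 / 2 : ℂ) * dbar s z) (Metric.closedBall z₀ (r / 2)) :=
      Integrable.const_mul ((hdb.mono hsub).integrableOn_compact hK) _
    refine Integrable.congr h1 ?_
    filter_upwards [hae] with z hz
    rw [(h z hz.1 hz.2).2.2.2]
    ring

namespace RiemannSurface

section Coefficients

variable {M : Type*} [TopologicalSpace M]

theorem comp_symm_eventuallyEq {e e' : OpenPartialHomeomorph M ℂ} (f : M → ℂ) {z : ℂ}
    (hz : z ∈ e.target) (hz' : e.symm z ∈ e'.source) :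
    f ∘ e.symm =ᶠ[𝓝 z] (f ∘ e'.symm) ∘ (e' ∘ e.symm) := by
  filter_upwards [(e.symm.trans e').open_source.mem_nhds
    (show z ∈ (e.symm.trans e').source by simp [hz, hz'])] with w hw
  have hw2 : e.symm w ∈ e'.source := hw.2
  simp [e'.left_inv hw2]

variable [ChartedSpace ℂ M]

theorem eventually_nhdsNE_of_chart {P : M → Prop} {p : M}
    (h : ∀ᶠ z in 𝓝[≠] (chartAt ℂ p p), z ∈ (chartAt ℂ p).target → P ((chartAt ℂ p).symm z)) :
    ∀ᶠ q in 𝓝[≠] p, P q := by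
  have hp := mem_chart_source ℂ p
  rw [eventually_nhdsWithin_iff] at h ⊢
  filter_upwards [((chartAt ℂ p).continuousAt hp).eventually h,
    (chartAt ℂ p).open_source.mem_nhds hp] with q hq hqs hne
  have := hq (fun h' => hne ((chartAt ℂ p).injOn hqs hp h')) ((chartAt ℂ p).map_source hqs)
  rwa [(chartAt ℂ p).left_inv hqs] at this

/-- `f` is holomorphic and nonzero at `p`. -/
def IsRegularAt (f : M → ℂ) (p : M) : Prop :=
  AnalyticAt ℂ (f ∘ (chartAt ℂ p).symm) (chartAt ℂ p p) ∧ f p ≠ 0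

theorem IsRegularAt.order_eq_zero {f : M → ℂ} {p : M} (h : IsRegularAt f p) : order f p = 0 := by
  rw [order, h.1.meromorphicOrderAt_eq, h.1.analyticOrderAt_eq_zero.2 (by simpa using h.2)]
  rfl

variable [IsManifold 𝓘(ℂ) ω M]

theorem coeffOne_d_of_complex {e : OpenPartialHomeomorph M ℂ} (he : e ∈ atlas ℂ M)
    {f : M → ℂ} {z : ℂ} (hz : z ∈ e.target) (hf : DifferentiableAt ℂ (f ∘ e.symm) z) (v : ℂ) :
    coeffOne e (d f) v z = deriv (f ∘ e.symm) z * v := by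
  have h : HasFDerivAt (f ∘ e.symm) _ z := hf.hasDerivAt.hasFDerivAt.restrictScalars ℝ
  rw [coeffOne_d he hz h.differentiableAt, h.fderiv]
  simp [mul_comm]

theorem coeffOne_zeroPrimitive {e : OpenPartialHomeomorph M ℂ} (he : e ∈ atlas ℂ M)
    {f : M → ℂ} {z : ℂ} (hz : z ∈ e.target) (hf : DifferentiableAt ℂ (f ∘ e.symm) z) (v : ℂ) :
    coeffOne e (zeroPrimitive f) v z = zeroCoeff (f ∘ e.symm) z * v := by
  have h : coeffOne e (zeroPrimitive f) v z = (1 / (f (e.symm z) *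
      (1 + f (e.symm z) * conj (f (e.symm z))))) * coeffOne e (d f) v z := rfl
  rw [h, coeffOne_d_of_complex he hz hf, zeroCoeff]
  simp only [Function.comp_apply]
  ring

theorem coeffTwo_sphericalForm {e : OpenPartialHomeomorph M ℂ} (he : e ∈ atlas ℂ M)
    {f : M → ℂ} {z : ℂ} (hz : z ∈ e.target) (hf : DifferentiableAt ℂ (f ∘ e.symm) z) :
    coeffTwo e (sphericalForm f) z = 2 * I * sphericalDensity (f ∘ e.symm) z := by
  have h : coeffTwo e (sphericalForm f) z = (1 / (1 + f (e.symm z) * conj (f (e.symm z))) ^ 2) *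
    coeffTwo e (wedge (conjForm (d f)) (d f)) z := rfl
  have h1 : ∀ v, coeffOne e (conjForm (d f)) v z = conj (coeffOne e (d f) v z) := fun v => rfl
  rw [h, coeffTwo_wedge, h1, h1, coeffOne_d_of_complex he hz hf, coeffOne_d_of_complex he hz hf,
    sphericalDensity]
  simp only [Function.comp_apply, map_mul, conj_I, mul_one]
  ring

theorem coeffTwo_wedge_zeroPrimitive_d {e : OpenPartialHomeomorph M ℂ} (he : e ∈ atlas ℂ M)
    {f ψ : M → ℂ} {z : ℂ} (hz : z ∈ e.target) (hf : DifferentiableAt ℂ (f ∘ e.symm) z)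
    (hψ : DifferentiableAt ℝ (ψ ∘ e.symm) z) :
    coeffTwo e (wedge (zeroPrimitive f) (d ψ)) z =
      -I * (zeroCoeff (f ∘ e.symm) z * dbar (ψ ∘ e.symm) z) := by
  rw [coeffTwo_wedge, coeffOne_zeroPrimitive he hz hf, coeffOne_zeroPrimitive he hz hf,
    coeffOne_d he hz hψ, coeffOne_d he hz hψ, dbar]
  linear_combination (zeroCoeff (f ∘ e.symm) z) * (fderiv ℝ (ψ ∘ e.symm) z I) * I_mul_I

theorem contDiffOn_comp_symm {e : OpenPartialHomeomorph M ℂ} (he : e ∈ atlas ℂ M) {ψ : M → ℂ}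
    (hψ : ContMDiff 𝓘(ℝ, ℂ) 𝓘(ℝ, ℂ) ∞ ψ) : ContDiffOn ℝ ∞ (ψ ∘ e.symm) e.target := by
  have := isManifold_real M
  have h := contMDiffOn_symm_of_mem_maximalAtlas (I := 𝓘(ℝ, ℂ)) (n := ∞)
    (IsManifold.subset_maximalAtlas he)
  exact (hψ.comp_contMDiffOn h).contDiffOn

theorem IsMeromorphic.meromorphicAt {f : M → ℂ} (hf : IsMeromorphic f)
    {e : OpenPartialHomeomorph M ℂ} (he : e ∈ atlas ℂ M) {z : ℂ} (hz : z ∈ e.target) :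
    MeromorphicAt (f ∘ e.symm) z :=
  ((hf (e.symm z)).comp_analyticAt (f := f ∘ (chartAt ℂ (e.symm z)).symm)
    (g := chartAt ℂ (e.symm z) ∘ e.symm)
    (analyticAt_transition he (chart_mem_atlas ℂ _) hz (mem_chart_source ℂ _))).congr
    ((comp_symm_eventuallyEq f hz (mem_chart_source ℂ _)).symm.filter_mono nhdsWithin_le_nhds)

/-- The order does not depend on the chart because transitions are holomorphic with nonzero
derivative. -/
theorem meromorphicOrderAt_comp_symm (f : M → ℂ)
    {e : OpenPartialHomeomorph M ℂ} (he : e ∈ atlas ℂ M) {z : ℂ} (hz : z ∈ e.target) :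
    meromorphicOrderAt (f ∘ e.symm) z = order f (e.symm z) := by
  have hc := mem_chart_source ℂ (e.symm z)
  rw [meromorphicOrderAt_congr
    ((comp_symm_eventuallyEq f hz hc).filter_mono nhdsWithin_le_nhds),
    meromorphicOrderAt_comp_of_deriv_ne_zero (analyticAt_transition he (chart_mem_atlas ℂ _) hz hc)
      (deriv_transition_ne_zero he (chart_mem_atlas ℂ _) hz hc)]
  rfl

theorem analyticAt_comp_symm_of_analyticAt {f : M → ℂ} {e e' : OpenPartialHomeomorph M ℂ}
    (he : e ∈ atlas ℂ M) (he' : e' ∈ atlas ℂ M) {z : ℂ} (hz : z ∈ e.target)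
    (hz' : e.symm z ∈ e'.source) (hf : AnalyticAt ℂ (f ∘ e'.symm) (e' (e.symm z))) :
    AnalyticAt ℂ (f ∘ e.symm) z :=
  (AnalyticAt.comp (f := e' ∘ e.symm) hf (analyticAt_transition he he' hz hz')).congr
    (comp_symm_eventuallyEq f hz hz').symm

theorem IsRegularAt.analyticAt {f : M → ℂ} {e : OpenPartialHomeomorph M ℂ} (he : e ∈ atlas ℂ M)
    {z : ℂ} (hz : z ∈ e.target) (h : IsRegularAt f (e.symm z)) : AnalyticAt ℂ (f ∘ e.symm) z :=
  analyticAt_comp_symm_of_analyticAt he (chart_mem_atlas ℂ _) hz (mem_chart_source ℂ _) h.1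

theorem isRegularAt_of_analyticAt {f : M → ℂ} {e : OpenPartialHomeomorph M ℂ} (he : e ∈ atlas ℂ M)
    {p : M} (hp : p ∈ e.source) (h : AnalyticAt ℂ (f ∘ e.symm) (e p)) (h0 : f p ≠ 0) :
    IsRegularAt f p := by
  refine ⟨analyticAt_comp_symm_of_analyticAt (chart_mem_atlas ℂ p) he
    (mem_chart_target ℂ p) ?_ ?_, h0⟩
  · simpa using hp
  · simpa using h

theorem IsMeromorphic.eventually_isRegularAt {f : M → ℂ} (hf : IsMeromorphic f) {p : M}
    (h0 : order f p ≠ ⊤) : ∀ᶠ q in 𝓝[≠] p, IsRegularAt f q := by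
  refine eventually_nhdsNE_of_chart ?_
  filter_upwards [(hf p).eventually_analyticAt,
    (meromorphicOrderAt_ne_top_iff_eventually_ne_zero (hf p)).1 h0] with z hz1 hz2 hz3
  refine isRegularAt_of_analyticAt (chart_mem_atlas ℂ p) ((chartAt ℂ p).map_target hz3) ?_ hz2
  rwa [(chartAt ℂ p).right_inv hz3]

theorem eventually_order_eq_top {f : M → ℂ} {p : M} (h0 : order f p = ⊤) :
    ∀ᶠ q in 𝓝[≠] p, order f q = ⊤ := by
  refine eventually_nhdsNE_of_chart ?_
  have h1 := meromorphicOrderAt_eq_top_iff.1 h0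
  filter_upwards [eventually_eventually_nhdsWithin.2 h1, self_mem_nhdsWithin] with z hz hne hzt
  rw [← meromorphicOrderAt_comp_symm f (chart_mem_atlas ℂ p) hzt, meromorphicOrderAt_eq_top_iff]
  rw [nhdsWithin_eq_nhds.2 (isOpen_compl_singleton.mem_nhds hne)] at hz
  exact hz.filter_mono nhdsWithin_le_nhds

/-- Identity theorem: infinite order spreads to a neighbourhood, and near a point of finite order
all other points are regular, so the points of infinite order form a clopen set. -/
theorem IsMeromorphic.order_ne_top [ConnectedSpace M] {f : M → ℂ} (hf : IsMeromorphic f)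
    (hf0 : ∃ p, order f p ≠ ⊤) (p : M) : order f p ≠ ⊤ := by
  have hclopen : IsClopen {q | order f q = ⊤} := by
    constructor
    · rw [← isOpen_compl_iff, isOpen_iff_mem_nhds]
      intro q hq
      have h := hf.eventually_isRegularAt hq
      rw [eventually_nhdsWithin_iff] at h
      filter_upwards [h] with x hx
      by_cases hxq : x = q
      · exact hxq ▸ hq
      · show order f x ≠ ⊤
        rw [(hx hxq).order_eq_zero]
        simp
    · rw [isOpen_iff_mem_nhds]
      intro q hq
      have h := eventually_order_eq_top hq
      rw [eventually_nhdsWithin_iff] at h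
      filter_upwards [h] with x hx
      by_cases hxq : x = q
      · exact hxq ▸ hq
      · exact hx hxq
  rcases isClopen_iff.1 hclopen with h | h
  · intro hp
    exact (h ▸ (show p ∈ {q | order f q = ⊤} from hp) : p ∈ (∅ : Set M))
  · obtain ⟨q, hq⟩ := hf0
    exact absurd (h ▸ mem_univ q : q ∈ {q | order f q = ⊤}) hq

/-- An infinite set would accumulate by compactness, yet every point has a punctured neighbourhood
of regular points. -/
theorem IsMeromorphic.finite_irregular [CompactSpace M] {f : M → ℂ} (hf : IsMeromorphic f)
    (h0 : ∀ p, order f p ≠ ⊤) : {p | ¬IsRegularAt f p}.Finite := by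
  by_contra hinf
  obtain ⟨p, hp⟩ := Set.Infinite.exists_accPt_principal hinf
  rw [accPt_iff_frequently_nhdsNE] at hp
  exact hp ((hf.eventually_isRegularAt (h0 p)).mono fun q hq => not_not.2 hq)

theorem IsMeromorphic.ae_isRegularAt [CompactSpace M] {f : M → ℂ} (hf : IsMeromorphic f)
    (h0 : ∀ p, order f p ≠ ⊤) (e : OpenPartialHomeomorph M ℂ) :
    ∀ᵐ z ∂(volume.restrict e.target), IsRegularAt f (e.symm z) := by
  filter_upwards [ae_restrict_target_of_finite (hf.finite_irregular h0) e] with z hz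
  simpa using hz

theorem IsMeromorphic.locallyIntegrableOn_zeroCoeff {f : M → ℂ} (hf : IsMeromorphic f)
    (h0 : ∀ p, order f p ≠ ⊤) {e : OpenPartialHomeomorph M ℂ} (he : e ∈ atlas ℂ M) :
    LocallyIntegrableOn (zeroCoeff (f ∘ e.symm)) e.target := fun z hz =>
  ((integrableAtFilter_zeroCoeff_and_sphericalDensity (hf.meromorphicAt he hz)
    (by rw [meromorphicOrderAt_comp_symm f he hz]; exact h0 _)).1).filter_mono nhdsWithin_le_nhds

theorem IsMeromorphic.locallyIntegrableOn_sphericalDensity {f : M → ℂ} (hf : IsMeromorphic f)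
    (h0 : ∀ p, order f p ≠ ⊤) {e : OpenPartialHomeomorph M ℂ} (he : e ∈ atlas ℂ M) :
    LocallyIntegrableOn (sphericalDensity (f ∘ e.symm)) e.target := fun z hz =>
  ((integrableAtFilter_zeroCoeff_and_sphericalDensity (hf.meromorphicAt he hz)
    (by rw [meromorphicOrderAt_comp_symm f he hz]; exact h0 _)).2).filter_mono nhdsWithin_le_nhds

theorem IsMeromorphic.locIntegrableOne_zeroPrimitive [CompactSpace M] {f : M → ℂ}
    (hf : IsMeromorphic f) (h0 : ∀ p, order f p ≠ ⊤) : LocIntegrableOne (zeroPrimitive f) := by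
  intro e he v
  refine LocallyIntegrableOn.congr ?_ ((hf.locallyIntegrableOn_zeroCoeff h0 he).smul v)
  filter_upwards [hf.ae_isRegularAt h0 e, ae_restrict_mem e.open_target.measurableSet] with z hz hzt
  rw [coeffOne_zeroPrimitive he hzt (hz.analyticAt he hzt).differentiableAt]
  simp [mul_comm]

theorem IsMeromorphic.locIntegrableTwo_smul_sphericalForm [CompactSpace M] {f : M → ℂ}
    (hf : IsMeromorphic f) (h0 : ∀ p, order f p ≠ ⊤) {φ : M → ℂ} (hφ : Continuous φ) :
    LocIntegrableTwo (fun p => φ p • sphericalForm f p) := by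
  intro e he
  have hc : ContinuousOn (fun z => φ (e.symm z) * (2 * I)) e.target :=
    (hφ.comp_continuousOn e.continuousOn_symm).mul continuousOn_const
  refine LocallyIntegrableOn.congr ?_ ((hf.locallyIntegrableOn_sphericalDensity h0 he).continuousOn_mul
    hc e.open_target.isLocallyClosed)
  filter_upwards [hf.ae_isRegularAt h0 e, ae_restrict_mem e.open_target.measurableSet] with z hz hzt
  rw [coeffTwo_smul, coeffTwo_sphericalForm he hzt (hz.analyticAt he hzt).differentiableAt]
  ring

theorem IsMeromorphic.locIntegrableTwo_sphericalForm [CompactSpace M] {f : M → ℂ}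
    (hf : IsMeromorphic f) (h0 : ∀ p, order f p ≠ ⊤) : LocIntegrableTwo (sphericalForm f) := by
  have := hf.locIntegrableTwo_smul_sphericalForm h0 (φ := fun _ => 1) continuous_const
  intro e he
  refine (this e he).congr (Eventually.of_forall fun z => ?_)
  rw [coeffTwo_smul, one_mul]

theorem IsMeromorphic.locIntegrableTwo_wedge [CompactSpace M] {f : M → ℂ}
    (hf : IsMeromorphic f) (h0 : ∀ p, order f p ≠ ⊤) {φ : M → ℂ}
    (hφ : ContMDiff 𝓘(ℝ, ℂ) 𝓘(ℝ, ℂ) ∞ φ) :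
    LocIntegrableTwo (wedge (zeroPrimitive f) (d φ)) := by
  intro e he
  have hs := contDiffOn_comp_symm he hφ
  have hs' : ContinuousOn (fderiv ℝ (φ ∘ e.symm)) e.target :=
    hs.continuousOn_fderiv_of_isOpen e.open_target (by norm_cast)
  have hc : ContinuousOn (fun z => -I * dbar (φ ∘ e.symm) z) e.target := by
    unfold dbar; fun_prop
  refine LocallyIntegrableOn.congr ?_ ((hf.locallyIntegrableOn_zeroCoeff h0 he).continuousOn_mul
    hc e.open_target.isLocallyClosed)
  filter_upwards [hf.ae_isRegularAt h0 e, ae_restrict_mem e.open_target.measurableSet] with z hz hzt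
  rw [coeffTwo_wedge_zeroPrimitive_d he hzt (hz.analyticAt he hzt).differentiableAt
    ((hs.contDiffAt (e.open_target.mem_nhds hzt)).differentiableAt (by simp))]
  ring

end Coefficients

/-! ### The residue formula on the surface -/

section Residue

variable {M : Type*} [TopologicalSpace M]

theorem tsupport_indicator_comp_symm_subset [T2Space M] [CompactSpace M]
    {e : OpenPartialHomeomorph M ℂ} {ψ : M → ℂ} (hsub : tsupport ψ ⊆ e.source) :
    IsCompact (e '' tsupport ψ) ∧ e '' tsupport ψ ⊆ e.target ∧
      tsupport (e.target.indicator (ψ ∘ e.symm)) ⊆ e '' tsupport ψ := by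
  have hK : IsCompact (e '' tsupport ψ) :=
    (isClosed_tsupport _).isCompact.image_of_continuousOn (e.continuousOn.mono hsub)
  refine ⟨hK, ?_, closure_minimal (fun z hz => ?_) hK.isClosed⟩
  · rintro _ ⟨q, hq, rfl⟩
    exact e.map_source (hsub hq)
  · have hzt : z ∈ e.target := mem_of_indicator_ne_zero hz
    have h2 : ψ (e.symm z) ≠ 0 := by
      rwa [Function.mem_support, indicator_of_mem hzt] at hz
    exact ⟨e.symm z, subset_tsupport _ h2, e.right_inv hzt⟩

variable [ChartedSpace ℂ M]

theorem d_eq_zero_of_notMem_tsupport {ψ : M → ℂ} {q : M} (hq : q ∉ tsupport ψ) : d ψ q = 0 := by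
  have h := (notMem_tsupport_iff_eventuallyEq.1 hq).mfderiv_eq (I := 𝓘(ℝ, ℂ)) (I' := 𝓘(ℝ, ℂ))
  rw [d, h]
  exact mfderiv_const

theorem wedge_zero (α : OneForm M) {β : OneForm M} {q : M} (h : β q = 0) : wedge α β q = 0 := by
  ext v
  rw [wedge_apply, h]
  simp

theorem d_finsetSum {ι : Type*} (s : Finset ι) {ψ : ι → M → ℂ}
    (hψ : ∀ i ∈ s, ContMDiff 𝓘(ℝ, ℂ) 𝓘(ℝ, ℂ) ∞ (ψ i)) (q : M) :
    d (fun x => ∑ i ∈ s, ψ i x) q = ∑ i ∈ s, d (ψ i) q := by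
  classical
  -- The induction runs on `HasMFDerivAt`, which also carries the differentiability of the partial
  -- sums.
  suffices h : ∀ L : TangentSpace 𝓘(ℝ, ℂ) q →L[ℝ] ℂ, L = ∑ i ∈ s, d (ψ i) q →
      HasMFDerivAt 𝓘(ℝ, ℂ) 𝓘(ℝ, ℂ) (fun x => ∑ i ∈ s, ψ i x) q L from (h _ rfl).mfderiv
  induction s using Finset.induction_on with
  | empty =>
    rintro L rfl
    exact hasMFDerivAt_const (I := 𝓘(ℝ, ℂ)) (I' := 𝓘(ℝ, ℂ)) (0 : ℂ) q
  | insert i s hi ih =>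
    intro L hL
    rw [Finset.sum_insert hi] at hL
    have h1 : HasMFDerivAt 𝓘(ℝ, ℂ) 𝓘(ℝ, ℂ) (ψ i) q (d (ψ i) q) :=
      ((hψ i (Finset.mem_insert_self i s)).mdifferentiableAt (by simp)).hasMFDerivAt
    have h2 := h1.add (ih (fun k hk => hψ k (Finset.mem_insert_of_mem hk)) _ rfl)
    have h3 : (fun x => ∑ k ∈ insert i s, ψ k x) = ψ i + fun x => ∑ k ∈ s, ψ k x :=
      funext fun x => Finset.sum_insert hi
    rw [h3, hL]
    exact h2

theorem wedge_finsetSum {ι : Type*} (s : Finset ι) (α : OneForm M) (β : ι → OneForm M)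
    {γ : OneForm M} {q : M} (h : γ q = ∑ i ∈ s, β i q) : wedge α γ q = ∑ i ∈ s, wedge α (β i) q := by
  ext v
  rw [wedge_apply, h]
  simp only [ContinuousAlternatingMap.sum_apply, wedge_apply, sum_apply,
    Finset.mul_sum, Finset.sum_sub_distrib]

variable [IsManifold 𝓘(ℂ) ω M]

/-- The support of `ψ` is carried to a compact subset of the chart target, so the extension by zero
vanishes near every point outside the target. -/
theorem contDiff_indicator_comp_symm [T2Space M] [CompactSpace M] {e : OpenPartialHomeomorph M ℂ}
    (he : e ∈ atlas ℂ M) {ψ : M → ℂ} (hψ : ContMDiff 𝓘(ℝ, ℂ) 𝓘(ℝ, ℂ) ∞ ψ)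
    (hsub : tsupport ψ ⊆ e.source) : ContDiff ℝ ∞ (e.target.indicator (ψ ∘ e.symm)) := by
  obtain ⟨hK, hKt, hs⟩ := tsupport_indicator_comp_symm_subset hsub
  rw [contDiff_iff_contDiffAt]
  intro z
  by_cases hz : z ∈ e.target
  · have hn := e.open_target.mem_nhds hz
    exact ((contDiffOn_comp_symm he hψ).contDiffAt hn).congr_of_eventuallyEq
      (eqOn_indicator.eventuallyEq_of_mem hn)
  · have h1 : z ∉ tsupport (e.target.indicator (ψ ∘ e.symm)) := fun h => hz (hKt (hs h))
    exact contDiffAt_const.congr_of_eventuallyEq (notMem_tsupport_iff_eventuallyEq.1 h1)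

/-- Near each point, the current `ψ ↦ ∫ ψ Ω + ∫ η ∧ dψ`, with `Ω = df̄ ∧ df / (1 + f f̄)²` and
`η = df / (f (1 + f f̄))`, is a multiple of the point evaluation. -/
theorem IsMeromorphic.exists_nhds_integral_eq [T2Space M] [CompactSpace M] {f : M → ℂ}
    (hf : IsMeromorphic f) (h0 : ∀ p, order f p ≠ ⊤) (p : M) :
    ∃ U : Set M, IsOpen U ∧ p ∈ U ∧ (∀ q ∈ U, q ≠ p → zeroMult f q = 0) ∧
      ∀ ψ : M → ℂ, ContMDiff 𝓘(ℝ, ℂ) 𝓘(ℝ, ℂ) ∞ ψ → tsupport ψ ⊆ U →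
        integral (fun q => ψ q • sphericalForm f q + wedge (zeroPrimitive f) (d ψ) q)
          = 2 * Real.pi * I * (zeroMult f p * ψ p) := by
  set e := chartAt ℂ p with he_def
  have he : e ∈ atlas ℂ M := chart_mem_atlas ℂ p
  have hp : p ∈ e.source := mem_chart_source ℂ p
  obtain ⟨r, hr, s, hs, h⟩ := exists_local_form (hf p) (h0 p)
  set g := f ∘ e.symm with hg
  refine ⟨e.source ∩ e ⁻¹' Metric.ball (e p) r,
    e.continuousOn.isOpen_inter_preimage e.open_source Metric.isOpen_ball,
    ⟨hp, Metric.mem_ball_self hr⟩, ?_, ?_⟩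
  · rintro q ⟨hq, hqb⟩ hqp
    obtain ⟨h1, h2, -, -⟩ := h (e q) hqb fun h' => hqp (e.injOn hq hp h')
    have h3 : IsRegularAt f q := isRegularAt_of_analyticAt he hq h1 (by simpa [hg, e.left_inv hq] using h2)
    simp [zeroMult, h3.order_eq_zero]
  · intro ψ hψ hsubU
    have hsub : tsupport ψ ⊆ e.source := hsubU.trans inter_subset_left
    obtain ⟨hK, hKt, hts⟩ := tsupport_indicator_comp_symm_subset hsub
    have hsm := contDiff_indicator_comp_symm he hψ hsub
    set ψ' := e.target.indicator (ψ ∘ e.symm) with hψ'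
    have hKb : e '' tsupport ψ ⊆ Metric.ball (e p) r := by
      rintro _ ⟨q, hq, rfl⟩
      exact (hsubU hq).2
    have hc : HasCompactSupport ψ' := hK.of_isClosed_subset (isClosed_tsupport _) hts
    have hmain := integral_zeroCoeff_mul_dbar hs (fun z hz hne => (h z hz hne).2.2)
      (hsm.of_le (by norm_cast)) hc (hts.trans hKb)
    set Ω : TwoForm M := fun q => ψ q • sphericalForm f q + wedge (zeroPrimitive f) (d ψ) q with hΩ
    have hzero : ∀ q ∉ tsupport ψ, Ω q = 0 := fun q hq => by
      simp only [hΩ, image_eq_zero_of_notMem_tsupport hq,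
        wedge_zero _ (d_eq_zero_of_notMem_tsupport hq), add_zero]
      exact zero_smul ℂ (sphericalForm f q)
    have hadd : ∀ z, coeffTwo e Ω z = coeffTwo e (fun q => ψ q • sphericalForm f q) z +
      coeffTwo e (wedge (zeroPrimitive f) (d ψ)) z := fun z => rfl
    have hint : IntegrableOn (coeffTwo e Ω) e.target := by
      have h1 : IntegrableOn (coeffTwo e Ω) (e '' tsupport ψ) :=
        (((hf.locIntegrableTwo_smul_sphericalForm h0 hψ.continuous e he).integrableOn_compact_subset
          hKt hK).add ((hf.locIntegrableTwo_wedge h0 hψ e he).integrableOn_compact_subset hKt hK))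
      refine h1.of_forall_sdiff_eq_zero e.open_target.measurableSet fun z hz => ?_
      exact coeffTwo_eq_zero (hzero _ fun hh => hz.2 ⟨e.symm z, hh, e.right_inv hz.1⟩)
    rw [integral_eq_setIntegral_chart he (fun q hq => hzero q fun hh => hq (hsub hh)) hint]
    -- The coefficients `2i · density` and `-i · zeroCoeff · dbar ψ` share the factor `i`, which
    -- turns the planar constant `2π` into `2πi`.
    have hcongr : ∫ z in e.target, coeffTwo e Ω z = ∫ z in e.target,
        I * (ψ' z * (2 * sphericalDensity g z) - zeroCoeff g z * dbar ψ' z) := by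
      refine integral_congr_ae ?_
      filter_upwards [hf.ae_isRegularAt h0 e, ae_restrict_mem e.open_target.measurableSet]
        with z hz hzt
      have hn := e.open_target.mem_nhds hzt
      have hd := (hz.analyticAt he hzt).differentiableAt
      have heq : ψ' =ᶠ[𝓝 z] ψ ∘ e.symm := eqOn_indicator.eventuallyEq_of_mem hn
      have hdb : dbar (ψ ∘ e.symm) z = dbar ψ' z := by rw [dbar, dbar, heq.fderiv_eq]
      rw [hadd, coeffTwo_smul, coeffTwo_sphericalForm he hzt hd, coeffTwo_wedge_zeroPrimitive_d he hzt
        hd (((contDiffOn_comp_symm he hψ).contDiffAt hn).differentiableAt (by simp)), hdb,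
        heq.self_of_nhds]
      simp only [Function.comp_apply, hg]
      ring
    rw [hcongr, setIntegral_eq_integral_of_forall_compl_eq_zero, integral_const_mul, hmain]
    · have : ψ' (e p) = ψ p := by
        rw [hψ', indicator_of_mem (e.map_source hp)]
        simp [e.left_inv hp]
      rw [this]
      simp only [zeroMult, order, ← he_def, ← hg]
      ring
    · intro z hz
      have h1 : z ∉ tsupport ψ' := fun hh => hz (hKt (hts hh))
      have h2 : dbar ψ' z = 0 := image_eq_zero_of_notMem_tsupport
        fun hh => h1 (tsupport_dbar_subset ψ' hh)
      rw [image_eq_zero_of_notMem_tsupport h1, h2]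
      simp

/-- The residue theorem for `df / (f (1 + f f̄))` as a current. -/
theorem IsMeromorphic.currentTwo_add_dCurrent [T2Space M] [CompactSpace M] {f : M → ℂ}
    (hf : IsMeromorphic f) (h0 : ∀ p, order f p ≠ ⊤) {φ : M → ℂ}
    (hφ : ContMDiff 𝓘(ℝ, ℂ) 𝓘(ℝ, ℂ) ∞ φ) :
    currentTwo (sphericalForm f) φ + dCurrent (currentOne (zeroPrimitive f)) φ
      = 2 * Real.pi * I * ∑ᶠ p, (zeroMult f p : ℂ) * φ p := by
  have := isManifold_real M
  choose U hUo hpU hU0 hU using hf.exists_nhds_integral_eq h0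
  obtain ⟨σ, hσ⟩ := SmoothPartitionOfUnity.exists_isSubordinate 𝓘(ℝ, ℂ) (s := univ) isClosed_univ U
    hUo (fun p _ => mem_iUnion.2 ⟨p, hpU p⟩)
  have hfin := finite_support_partitionOfUnity σ
  set s := hfin.toFinset with hs
  have hsum : ∀ q, ∑ p ∈ s, σ p q = 1 := fun q => by
    rw [← σ.sum_eq_one (mem_univ q)]
    refine (finsum_eq_sum_of_support_subset _ fun p hp => ?_).symm
    simp only [hs, Finite.coe_toFinset, mem_ofPred_eq]
    intro h
    apply hp
    simp [h]
  set ψ : M → M → ℂ := fun p q => (σ p q : ℂ) * φ q with hψ_def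
  have hψ : ∀ p, ContMDiff 𝓘(ℝ, ℂ) 𝓘(ℝ, ℂ) ∞ (ψ p) := fun p =>
    ((σ p).contMDiff.smul hφ).congr fun q => by simp [hψ_def]
  have hφs : φ = fun q => ∑ p ∈ s, ψ p q := by
    ext q
    simp only [hψ_def]
    rw [← Finset.sum_mul, ← ofReal_sum, hsum]
    simp
  have hψs : ∀ p, tsupport (ψ p) ⊆ U p := fun p =>
    (closure_mono fun q hq => by
      have : (σ p q : ℂ) ≠ 0 := left_ne_zero_of_mul hq
      exact_mod_cast this).trans (hσ p)
  have hloc : ∀ {χ : M → ℂ}, ContMDiff 𝓘(ℝ, ℂ) 𝓘(ℝ, ℂ) ∞ χ → LocIntegrableTwo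
      (fun q => χ q • sphericalForm f q + wedge (zeroPrimitive f) (d χ) q) := fun hχ e he =>
    (hf.locIntegrableTwo_smul_sphericalForm h0 hχ.continuous e he).add
      (hf.locIntegrableTwo_wedge h0 hχ e he)
  rw [currentTwo, dCurrent, currentOne, ← integral_twoForm_add
    (hf.locIntegrableTwo_smul_sphericalForm h0 hφ.continuous) (hf.locIntegrableTwo_wedge h0 hφ)]
  have hform : (fun q => φ q • sphericalForm f q + wedge (zeroPrimitive f) (d φ) q) =
      fun q => ∑ p ∈ s, (ψ p q • sphericalForm f q + wedge (zeroPrimitive f) (d (ψ p)) q) := by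
    ext1 q
    rw [Finset.sum_add_distrib, ← wedge_finsetSum s (zeroPrimitive f) (fun p => d (ψ p)) (γ := d φ)]
    · congr 1
      rw [congrFun hφs q]
      exact Finset.sum_smul (R := ℂ) (M := ℂ [⋀^Fin 2]→L[ℝ] ℂ)
    · rw [← d_finsetSum s fun p _ => hψ p, ← hφs]
  rw [hform, integral_finsetSum_twoForm s fun p _ => hloc (hψ p)]
  rw [Finset.sum_congr rfl fun p _ => hU p (ψ p) (hψ p) (hψs p), ← Finset.mul_sum]
  congr 1
  -- `U p` contains no zero of `f` other than possibly `p`, so at a zero `q` every `σ p` with `p ≠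
  -- q` vanishes and `σ q q = 1`.
  have hz : ∀ p q, p ≠ q → σ p q * (zeroMult f q : ℝ) = 0 := fun p q hpq => by
    by_cases hq : q ∈ U p
    · simp [hU0 p q hq hpq.symm]
    · rw [image_eq_zero_of_notMem_tsupport fun hh => hq (hσ p hh), zero_mul]
  have hone : ∀ q, (zeroMult f q : ℝ) = σ q q * zeroMult f q := fun q => by
    by_cases hq : q ∈ s
    · conv_lhs => rw [← one_mul (zeroMult f q : ℝ), ← hsum q, Finset.sum_mul]
      exact Finset.sum_eq_single q (fun p _ hpq => hz p q hpq) fun h => absurd hq h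
    · conv_lhs => rw [← one_mul (zeroMult f q : ℝ), ← hsum q, Finset.sum_mul]
      rw [Finset.sum_eq_zero fun p hp => hz p q fun h => hq (h ▸ hp)]
      have : σ q = 0 := by simpa [hs] using hq
      simp [this]
  rw [finsum_eq_sum_of_support_subset (s := s)]
  · refine Finset.sum_congr rfl fun p _ => ?_
    simp only [hψ_def]
    rw [← mul_assoc]
    congr 1
    have := hone p
    rw [mul_comm] at this
    exact_mod_cast this.symm
  · intro p hp
    have h1 : (zeroMult f p : ℂ) ≠ 0 := left_ne_zero_of_mul hp
    simp only [hs, Finite.coe_toFinset, mem_ofPred_eq]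
    intro h
    apply h1
    have := hone p
    rw [h] at this
    simpa using this

end Residue

/-! ### Passage from `f` to `1/f` -/

section Inverse

variable {M : Type*} [TopologicalSpace M] [ChartedSpace ℂ M]

theorem IsMeromorphic.inv {f : M → ℂ} (hf : IsMeromorphic f) : IsMeromorphic f⁻¹ :=
  fun p => (hf p).inv

theorem order_inv (f : M → ℂ) (p : M) : order f⁻¹ p = -order f p :=
  meromorphicOrderAt_inv (f := f ∘ (chartAt ℂ p).symm)

theorem order_inv_ne_top {f : M → ℂ} {p : M} (h0 : order f p ≠ ⊤) : order f⁻¹ p ≠ ⊤ := by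
  rw [order_inv]
  lift order f p to ℤ using h0 with n
  exact WithTop.coe_ne_top (a := -n)

theorem zeroMult_inv {f : M → ℂ} {p : M} (h0 : order f p ≠ ⊤) :
    zeroMult f⁻¹ p = poleMult f p := by
  rw [zeroMult, poleMult, order_inv]
  lift order f p to ℤ using h0 with n
  rfl

theorem IsRegularAt.zeroMult_eq_zero {f : M → ℂ} {p : M} (h : IsRegularAt f p) :
    zeroMult f p = 0 := by
  simp [zeroMult, h.order_eq_zero]

theorem IsRegularAt.poleMult_eq_zero {f : M → ℂ} {p : M} (h : IsRegularAt f p) :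
    poleMult f p = 0 := by
  simp [poleMult, h.order_eq_zero]

theorem integral_neg_twoForm [IsManifold 𝓘(ℂ) ω M] [T2Space M] [CompactSpace M] (Ω : TwoForm M) :
    integral (fun p => -Ω p) = -integral Ω := by
  rw [integral, integral, ← finsum_neg_distrib]
  refine finsum_congr fun p => ?_
  rw [← integral_neg]
  refine integral_congr_ae (Eventually.of_forall fun z => ?_)
  have : coeffTwo (chartAt ℂ p) (fun p => -Ω p) z = -coeffTwo (chartAt ℂ p) Ω z := rfl
  beta_reduce
  rw [this, mul_neg]

theorem wedge_congr_neg {α α' β : OneForm M} {p : M} (h : α p = -α' p) :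
    wedge α β p = -wedge α' β p := by
  ext v
  rw [wedge_apply, h, ContinuousAlternatingMap.neg_apply, wedge_apply]
  simp only [neg_apply]
  ring

variable [IsManifold 𝓘(ℂ) ω M]

theorem IsRegularAt.d_inv {f : M → ℂ} {p : M} (h : IsRegularAt f p)
    (v : TangentSpace 𝓘(ℝ, ℂ) p) : d f⁻¹ p v = -(f p ^ 2)⁻¹ * d f p v := by
  have h1 : MDifferentiableAt 𝓘(ℝ, ℂ) 𝓘(ℝ, ℂ) f p := by
    have := mdifferentiableAt_of_comp_symm (chart_mem_atlas ℂ p) (mem_chart_target ℂ p)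
      (h.1.differentiableAt.restrictScalars ℝ)
    simpa using this
  have h2 : HasFDerivAt (fun w : ℂ => w⁻¹) _ (f p) :=
    (hasFDerivAt_inv (𝕜 := ℂ) h.2).restrictScalars ℝ
  have h3 := (h2.hasMFDerivAt.comp p h1.hasMFDerivAt).mfderiv
  have h4 : d f⁻¹ p = _ := h3
  rw [h4]
  change (ContinuousLinearMap.restrictScalars ℝ
    (ContinuousLinearMap.toSpanSingleton ℂ (-(f p ^ 2)⁻¹))) (d f p v) = _
  simp [mul_comm]

theorem inv_one_add_inv_mul_conj {w : ℂ} (hw : w ≠ 0) :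
    1 + w⁻¹ * conj w⁻¹ = (1 + w * conj w) / (w * conj w) := by
  have : conj w ≠ 0 := (map_ne_zero _).2 hw
  rw [map_inv₀]
  field_simp
  ring

/-- Substitute `d(1/f) = -df/f²` and `1 + |1/f|² = (1 + |f|²)/|f|²`; a factor `f̄` remains. -/
theorem IsRegularAt.polePrimitive_eq {f : M → ℂ} {p : M} (h : IsRegularAt f p) :
    polePrimitive f p = -zeroPrimitive f⁻¹ p := by
  ext v
  have h1 : polePrimitive f p v = (conj (f p) / (1 + f p * conj (f p))) * d f p v := rfl
  have h2 : (-zeroPrimitive f⁻¹ p) v =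
    -((1 / ((f p)⁻¹ * (1 + (f p)⁻¹ * conj (f p)⁻¹))) * d f⁻¹ p v) := rfl
  have hf := h.2
  have hc : conj (f p) ≠ 0 := (map_ne_zero _).2 h.2
  have hne := one_add_mul_conj_ne_zero (f p)
  rw [h1, h2, h.d_inv, inv_one_add_inv_mul_conj h.2]
  field_simp

/-- Inversion is a rotation of the Riemann sphere and preserves its area form. -/
theorem IsRegularAt.sphericalForm_inv {f : M → ℂ} {p : M} (h : IsRegularAt f p) :
    sphericalForm f⁻¹ p = sphericalForm f p := by
  ext v
  have h1 : ∀ g : M → ℂ, sphericalForm g p v = (1 / (1 + g p * conj (g p)) ^ 2) *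
      (conj (d g p (v 0)) * d g p (v 1) - conj (d g p (v 1)) * d g p (v 0)) := fun g =>
    congrArg (fun x : ℂ => (1 / (1 + g p * conj (g p)) ^ 2) * x)
      (wedge_apply (conjForm (d g)) (d g) p v)
  have hf := h.2
  have hc : conj (f p) ≠ 0 := (map_ne_zero _).2 h.2
  have hne := one_add_mul_conj_ne_zero (f p)
  rw [h1, h1, h.d_inv, h.d_inv, Pi.inv_apply, inv_one_add_inv_mul_conj h.2]
  simp only [map_mul, map_neg, map_inv₀, map_pow]
  field_simp

theorem IsMeromorphic.locIntegrableOne_polePrimitive [CompactSpace M] {f : M → ℂ}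
    (hf : IsMeromorphic f) (h0 : ∀ p, order f p ≠ ⊤) : LocIntegrableOne (polePrimitive f) := by
  intro e he v
  refine LocallyIntegrableOn.congr ?_
    (hf.inv.locIntegrableOne_zeroPrimitive (fun p => order_inv_ne_top (h0 p)) e he v).neg
  filter_upwards [hf.ae_isRegularAt h0 e] with z hz
  simp only [coeffOne, hz.polePrimitive_eq]
  rfl

/-- This is the residue formula for `1/f`, whose zeros are the poles of `f`; the forms are compared
off the finite irregular set. -/
theorem IsMeromorphic.currentTwo_sub_dCurrent [T2Space M] [CompactSpace M] {f : M → ℂ}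
    (hf : IsMeromorphic f) (h0 : ∀ p, order f p ≠ ⊤) {φ : M → ℂ}
    (hφ : ContMDiff 𝓘(ℝ, ℂ) 𝓘(ℝ, ℂ) ∞ φ) :
    currentTwo (sphericalForm f) φ - dCurrent (currentOne (polePrimitive f)) φ
      = 2 * Real.pi * I * ∑ᶠ p, (poleMult f p : ℂ) * φ p := by
  have hfin := hf.finite_irregular h0
  have h := hf.inv.currentTwo_add_dCurrent (fun p => order_inv_ne_top (h0 p)) hφ
  simp_rw [fun p => zeroMult_inv (h0 p)] at h
  have h1 : currentTwo (sphericalForm f⁻¹) φ = currentTwo (sphericalForm f) φ :=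
    integral_congr_off_finite hfin fun p hp => by
      rw [IsRegularAt.sphericalForm_inv (not_not.1 hp)]
  have h2 : dCurrent (currentOne (polePrimitive f)) φ =
      -dCurrent (currentOne (zeroPrimitive f⁻¹)) φ := by
    rw [dCurrent, currentOne, dCurrent, currentOne, ← integral_neg_twoForm]
    exact integral_congr_off_finite hfin fun p hp =>
      wedge_congr_neg (IsRegularAt.polePrimitive_eq (not_not.1 hp))
  rw [h2, ← h1, sub_neg_eq_add, h]

end Inverse

/-! ### Lists with multiplicity and the number of zeros -/

section Counting

theorem sum_comp_eq_finsum {α : Type*} {m : ℕ} {a : Fin m → α} {μ : α → ℕ}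
    (h : ∀ p, {k : Fin m | a k = p}.ncard = μ p) (φ : α → ℂ) :
    ∑ k, φ (a k) = ∑ᶠ p, (μ p : ℂ) * φ p := by
  classical
  rw [finsum_eq_sum_of_support_subset (s := Finset.univ.image a)]
  · rw [Finset.sum_comp φ a]
    refine Finset.sum_congr rfl fun p _ => ?_
    rw [nsmul_eq_mul, ← h p, ← Set.ncard_coe_finset]
    simp
  · intro p hp
    have h1 : μ p ≠ 0 := by
      have := left_ne_zero_of_mul hp
      exact_mod_cast this
    rw [← h p] at h1
    obtain ⟨k, hk⟩ := Set.nonempty_of_ncard_ne_zero h1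
    have hk' : a k = p := hk
    simp [← hk']

/-- Replace each point `p` by `μ p` labelled copies: the disjoint union has `m` elements, and an
enumeration of it projects to the required list. -/
theorem exists_fin_of_finsum_eq {α : Type*} {m : ℕ} {μ : α → ℕ} {s : Finset α}
    (hs : ∀ p, μ p ≠ 0 → p ∈ s) (h : ∑ᶠ p, μ p = m) :
    ∃ a : Fin m → α, ∀ p, {k : Fin m | a k = p}.ncard = μ p := by
  classical
  rw [finsum_eq_sum_of_support_subset (s := s) μ fun p hp => hs p hp] at h
  have hcard : Fintype.card (Σ p : s, Fin (μ p)) = m := by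
    rw [Fintype.card_sigma, ← h, ← Finset.sum_coe_sort s]
    simp
  let E : (Σ p : s, Fin (μ p)) ≃ Fin m := Fintype.equivFinOfCardEq hcard
  refine ⟨fun k => (E.symm k).1, fun p => ?_⟩
  have h1 : {k : Fin m | ((E.symm k).1 : α) = p} = E '' {x | (x.1 : α) = p} := by
    ext k
    constructor
    · intro hk
      exact ⟨E.symm k, hk, by simp⟩
    · rintro ⟨x, hx, rfl⟩
      simpa using hx
  rw [h1, Set.ncard_image_of_injective _ E.injective]
  by_cases hp : p ∈ s
  · have h2 : {x : Σ p : s, Fin (μ p) | (x.1 : α) = p} =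
        Set.range fun i : Fin (μ p) => (⟨⟨p, hp⟩, i⟩ : Σ p : s, Fin (μ p)) := by
      ext ⟨⟨q, hq⟩, i⟩
      constructor
      · rintro rfl
        exact ⟨i, rfl⟩
      · rintro ⟨j, hj⟩
        exact congrArg (fun x : Σ p : s, Fin (μ p) => (x.1 : α)) hj.symm
    rw [h2, ← Set.image_univ, Set.ncard_image_of_injective _
      (sigma_mk_injective (β := fun p : s => Fin (μ p)) (i := ⟨p, hp⟩)), Set.ncard_univ]
    simp
  · have h2 : {x : Σ p : s, Fin (μ p) | (x.1 : α) = p} = ∅ := by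
      ext ⟨⟨q, hq⟩, i⟩
      simp only [mem_ofPred_eq, mem_empty_iff_false, iff_false]
      rintro rfl
      exact hp hq
    rw [h2, Set.ncard_empty]
    by_contra hne
    exact hp (hs p (Ne.symm hne))

theorem sum_diracCurrent {M : Type*} {m : ℕ} {a : Fin m → M} {μ : M → ℕ}
    (h : ∀ p, {k : Fin m | a k = p}.ncard = μ p) (φ : M → ℂ) :
    Real.pi * ∑ k, diracCurrent (a k) φ = 2 * Real.pi * I * ∑ᶠ p, (μ p : ℂ) * φ p := by
  rw [← sum_comp_eq_finsum h]
  simp only [diracCurrent]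
  rw [← Finset.mul_sum]
  ring

end Counting

section Degree

variable {M : Type*} [TopologicalSpace M] [ChartedSpace ℂ M] [IsManifold 𝓘(ℂ) ω M]

/-- A meromorphic function on a compact surface has as many zeros as poles. -/
theorem IsMeromorphic.finsum_zeroMult_eq_degree [T2Space M] [CompactSpace M] {f : M → ℂ}
    (hf : IsMeromorphic f) (h0 : ∀ p, order f p ≠ ⊤) : ∑ᶠ p, zeroMult f p = degree f := by
  have hfin := hf.finite_irregular h0
  have h1 := hf.currentTwo_add_dCurrent h0 (φ := fun _ => 1) contMDiff_const
  have h2 := hf.currentTwo_sub_dCurrent h0 (φ := fun _ => 1) contMDiff_const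
  -- Since `d1 = 0`, the boundary terms disappear and both identities compute the same total
  -- spherical integral.
  have hd : ∀ η : OneForm M, dCurrent (currentOne η) (fun _ : M => (1 : ℂ)) = 0 := by
    intro η
    have : ∀ p, wedge η (d fun _ : M => (1 : ℂ)) p = 0 := fun p => wedge_zero η mfderiv_const
    rw [dCurrent, currentOne, integral]
    refine finsum_eq_zero_of_forall_eq_zero fun p => ?_
    simp [coeffTwo_eq_zero (this _)]
  rw [hd, add_zero] at h1
  rw [hd, sub_zero, h1] at h2
  have h3 := mul_left_cancel₀ (by simp [Real.pi_ne_zero]) h2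
  simp only [mul_one] at h3
  -- The cast commutes with `finsum` because `μ` is supported on the finite irregular set.
  have hcast : ∀ μ : M → ℕ, (∀ p, IsRegularAt f p → μ p = 0) →
      ∑ᶠ p, (μ p : ℂ) = ((∑ᶠ p, μ p : ℕ) : ℂ) := fun μ hμ =>
    ((Nat.castAddMonoidHom ℂ).map_finsum (hfin.subset fun p hp hr => hp (hμ p hr))).symm
  rw [hcast _ fun p hp => hp.zeroMult_eq_zero, hcast _ fun p hp => hp.poleMult_eq_zero] at h3
  exact_mod_cast h3

end Degree

end RiemannSurface

end

theorem mainTheorem2 {M : Type*} [TopologicalSpace M] [T2Space M] [CompactSpace M]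
    [ConnectedSpace M] [ChartedSpace ℂ M] [IsManifold 𝓘(ℂ) ω M]
    (f : M → ℂ) (hf : RiemannSurface.IsMeromorphic f)
    (hf0 : ∃ p, RiemannSurface.order f p ≠ ⊤)
    (m : ℕ) (hm : RiemannSurface.degree f = m) :
    -- the zeros, and the poles, can be listed as families of `m` points
    (∃ a : Fin m → M, RiemannSurface.ListsZeros f a) ∧
    (∃ b : Fin m → M, RiemannSurface.ListsPoles f b) ∧
    -- the three forms are locally integrable, so that they define currents
    RiemannSurface.LocIntegrableTwo (RiemannSurface.sphericalForm f) ∧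
    RiemannSurface.LocIntegrableOne (RiemannSurface.zeroPrimitive f) ∧
    RiemannSurface.LocIntegrableOne (RiemannSurface.polePrimitive f) ∧
    -- the two identities between currents, tested on all smooth functions
    ∀ a b : Fin m → M, RiemannSurface.ListsZeros f a → RiemannSurface.ListsPoles f b →
      ∀ φ : M → ℂ, ContMDiff 𝓘(ℝ, ℂ) 𝓘(ℝ, ℂ) ∞ φ →
        RiemannSurface.currentTwo (RiemannSurface.sphericalForm f) φ =
            -RiemannSurface.dCurrent
                (RiemannSurface.currentOne (RiemannSurface.zeroPrimitive f)) φ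
              + Real.pi * ∑ k, RiemannSurface.diracCurrent (a k) φ ∧
        RiemannSurface.currentTwo (RiemannSurface.sphericalForm f) φ =
            RiemannSurface.dCurrent
                (RiemannSurface.currentOne (RiemannSurface.polePrimitive f)) φ
              + Real.pi * ∑ j, RiemannSurface.diracCurrent (b j) φ := by
  have h0 := hf.order_ne_top hf0
  have hfin := hf.finite_irregular h0
  refine ⟨?_, ?_, hf.locIntegrableTwo_sphericalForm h0, hf.locIntegrableOne_zeroPrimitive h0,
    hf.locIntegrableOne_polePrimitive h0, fun a b ha hb φ hφ => ⟨?_, ?_⟩⟩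
  -- `m` counts poles by definition, so listing the zeros needs the equality of the two counts.
  · exact RiemannSurface.exists_fin_of_finsum_eq (s := hfin.toFinset)
      (fun p hp => hfin.mem_toFinset.2 fun hr => hp hr.zeroMult_eq_zero)
      ((hf.finsum_zeroMult_eq_degree h0).trans hm)
  · exact RiemannSurface.exists_fin_of_finsum_eq (s := hfin.toFinset)
      (fun p hp => hfin.mem_toFinset.2 fun hr => hp hr.poleMult_eq_zero) hm
  · rw [RiemannSurface.sum_diracCurrent ha, ← hf.currentTwo_add_dCurrent h0 hφ]
    ring
  · rw [RiemannSurface.sum_diracCurrent hb, ← hf.currentTwo_sub_dCurrent h0 hφ]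
    ring
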